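/- Let $K$ be a field and let $n_1,\dots,n_4$ be positive integers with $\gcd(n_1,\dots,n_4)=1$ that minimally generate the numerical semigroup $S=\langle n_1,\dots,n_4\rangle$. Put $PF(S)=\{x\in\mathbb Z\setminus S : x+s\in S \text{ for all } s\in S\setminus\{0\}\}$ and assume that $S$ is pseudo-symmetric, i.e. $PF(S)=\{g/2,g\}$ with $g=\max PF(S)$. Let $\alpha_1,\alpha_2,\alpha_3,\alpha_4>1$ and $0<\alpha_{21}<\alpha_1$ be integers with \begin{align*} n_1&=\alpha_2\alpha_3(\alpha_4-1)+1,\\ n_2&=\alpha_{21}\alpha_3\alpha_4+(\alpha_1-\alpha_{21}-1)(\alpha_3-1)+\alpha_3,\\ n_3&=\alpha_1\alpha_4+(\alpha_1-\alpha_{21}-1)(\alpha_2-1)(\alpha_4-1)-\alpha_4+1,\\ n_4&=\alpha_1\alpha_2(\alpha_3-1)+\alpha_{21}(\alpha_2-1)+\alpha_2 \end{align*} (by a theorem of Komeda such integers exist for every 4-generated pseudo-symmetric numerical semigroup, after renumbering the generators). Let $A=K[X_1,\dots,X_4]$ be graded by $\deg X_i=n_i$, and regard $K[S]=K[t^{n_1},\dots,t^{n_4}]$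 as a graded $A$-module through $X_i\mapsto t^{n_i}$. A minimal graded free resolution $(\mathbf F,\phi)$ of $K[S]$ over $A$, given with homogeneous bases of its free modules, is called strongly indispensable if for every minimal graded free resolution $(\mathbf G,\theta)$ of $K[S]$ with homogeneous bases there is an injective map of graded complexes $\mathbf F\to\mathbf G$ that sends each basis element of $\mathbf F$ to a nonzero scalar multiple of a basis element of $\mathbf G$. Then $K[S]$ has a strongly indispensable minimal graded free resolution if and only if $\alpha_4>2$ and $\alpha_1-\alpha_{21}>2$. -/

import Mathlib

open MvPolynomial

noncomputable section

/-- The numerical semigroup `⟨n₁, n₂, n₃, n₄⟩ = {u₁ n₁ + ⋯ + u₄ n₄ | uᵢ ∈ ℕ}`. -/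
def numSemigroup (n : Fin 4 → ℕ) : AddSubmonoid ℕ :=
  AddSubmonoid.closure (Set.range n)

/-- `n₁, …, n₄` are positive, have greatest common divisor `1`, and form a minimal generating
system of the semigroup they generate. -/
structure IsMinimalGenerators (n : Fin 4 → ℕ) : Prop where
  pos : ∀ i, 0 < n i
  gcd_eq_one : Finset.univ.gcd n = 1
  minimal : ∀ i, n i ∉ AddSubmonoid.closure (n '' {j | j ≠ i})

/-- Pseudo-Frobenius numbers: `x ∈ ℤ ∖ S` with `x + s ∈ S` for all `s ∈ S ∖ {0}`. -/
def pseudoFrobenius (S : AddSubmonoid ℕ) : Set ℤ :=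
  {x | (∀ t ∈ S, x ≠ (t : ℤ)) ∧ ∀ s ∈ S, s ≠ 0 → ∃ t ∈ S, x + (s : ℤ) = (t : ℤ)}

/-- `S` is pseudo-symmetric: `PF(S) = {g / 2, g}`, where `g = 2 h` is the Frobenius number,
i.e. the largest pseudo-Frobenius number. -/
def IsPseudoSymmetric (S : AddSubmonoid ℕ) : Prop :=
  ∃ h : ℤ, IsGreatest (pseudoFrobenius S) (2 * h) ∧ pseudoFrobenius S = {h, 2 * h}

/-- The map `K[X₁, …, X₄] → K[t]`, `Xᵢ ↦ t ^ nᵢ`. -/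
def toricMap (K : Type*) [Field K] (n : Fin 4 → ℕ) :
    MvPolynomial (Fin 4) K →ₐ[K] Polynomial K :=
  aeval fun i => Polynomial.X ^ n i

/-- The semigroup ring `K[S] = K[t ^ n₁, …, t ^ n₄]`. -/
def semigroupRing (K : Type*) [Field K] (n : Fin 4 → ℕ) : Subalgebra K (Polynomial K) :=
  (toricMap K n).range

/-- `K[S]` as a module over `A = K[X₁, …, X₄]` through `Xᵢ ↦ t ^ nᵢ`. -/
instance semigroupRingModule (K : Type*) [Field K] (n : Fin 4 → ℕ) :
    Module (MvPolynomial (Fin 4) K) (semigroupRing K n) :=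
  Module.compHom (toricMap K n).range (toricMap K n).rangeRestrict.toRingHom

/-- For the graded free module `⨁ₖ A[-deg k]`, whose `k`-th basis element has degree `deg k`:
the element `v` is homogeneous of degree `e` (where `Xᵢ` has degree `nᵢ`). -/
def IsHomogeneousVec {K : Type*} [Field K] (n : Fin 4 → ℕ) {r : ℕ} (deg : Fin r → ℕ)
    (v : Fin r → MvPolynomial (Fin 4) K) (e : ℕ) : Prop :=
  ∀ k, ∀ u ∈ (v k).support, Finsupp.weight n u + deg k = e

/-- A minimal graded free resolution
`⋯ → ⨁ⱼ A[-deg 1 j] → ⨁ⱼ A[-deg 0 j] → K[S] → 0` of `K[S]` over `A = K[X₁, …, X₄]`,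
together with homogeneous bases (the standard ones) of its free modules. -/
structure MinimalGradedResolution (K : Type*) [Field K] (n : Fin 4 → ℕ) where
  /-- the rank of the free module in homological degree `i` -/
  rank : ℕ → ℕ
  /-- the degrees of the basis elements in homological degree `i` -/
  deg : ∀ i, Fin (rank i) → ℕ
  /-- the differentials -/
  d : ∀ i, (Fin (rank (i + 1)) → MvPolynomial (Fin 4) K) →ₗ[MvPolynomial (Fin 4) K]
    (Fin (rank i) → MvPolynomial (Fin 4) K)
  /-- the augmentation -/
  aug : (Fin (rank 0) → MvPolynomial (Fin 4) K) →ₗ[MvPolynomial (Fin 4) K] semigroupRing K n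
  /-- the differentials preserve degrees -/
  d_homogeneous : ∀ i j, IsHomogeneousVec n (deg i) (d i (Pi.single j 1)) (deg (i + 1) j)
  /-- the augmentation preserves degrees -/
  aug_homogeneous : ∀ j, ∃ c : K,
    (aug (Pi.single j 1) : Polynomial K) = Polynomial.monomial (deg 0 j) c
  aug_surjective : Function.Surjective aug
  exact_zero : Function.Exact (d 0) aug
  exact_succ : ∀ i, Function.Exact (d (i + 1)) (d i)
  /-- minimality: the image of each differential lies in `(X₁, …, X₄)` times its target -/
  minimal : ∀ i j k, constantCoeff (d i (Pi.single j 1) k) = 0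

/-- `F` is strongly indispensable: for every minimal graded free resolution `G` of `K[S]` with
homogeneous bases there is an injective map of graded complexes `F → G` which sends every basis
element of `F` to a nonzero scalar multiple of a basis element of `G` (of the same degree). -/
def MinimalGradedResolution.StronglyIndispensable {K : Type*} [Field K] {n : Fin 4 → ℕ}
    (F : MinimalGradedResolution K n) : Prop :=
  ∀ G : MinimalGradedResolution K n,
    ∃ f : ∀ i, (Fin (F.rank i) → MvPolynomial (Fin 4) K) →ₗ[MvPolynomial (Fin 4) K]
        (Fin (G.rank i) → MvPolynomial (Fin 4) K),
      (∀ i, f i ∘ₗ F.d i = G.d i ∘ₗ f (i + 1)) ∧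
      (∀ i, Function.Injective (f i)) ∧
      ∀ i j, ∃ k, ∃ c : K, c ≠ 0 ∧ G.deg i k = F.deg i j ∧
        f i (Pi.single j 1) = Pi.single k (C c)

end

open MvPolynomial

noncomputable section

/-! ### Restricting vectors over the polynomial ring to prescribed degrees -/

section Restrict

variable {K : Type*} [Field K] {n : Fin 4 → ℕ}

/-! Put p = α₂₁, q = α₁ - α₂₁ - 1, a = α₂ - 1, b = α₃ - 1, c = α₄ - 1, so that the condition reads q
≥ 2 and c ≥ 2. Everything rests on an explicit minimal resolution 0 → A² → A⁶ → A⁵ → A → K[S],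
`komedaResolution`, and on the degrees of its basis elements.

Strong indispensability is decided by degrees. If no two degrees in the same homological position
differ by an element of S, a homogeneous comparison with another minimal resolution can only send
basis elements to multiples of basis elements (`stronglyIndispensable_of_deg`). If two degrees
differ by that of a monomial X^u ≠ 1, adding X^u times one basis element to the other produces a
second basis, and no resolution embeds monomially for both bases
(`not_stronglyIndispensable_of_deg`).

Exactness at A: five binomials rewrite every monomial to X 0 ^ e times a standard one, and there are
at most n 0 standard monomials for the n 0 residues modulo n 0, so they are separated by their
degrees (`standard_exponent_injective`). Further left, exactness is tested modulo X 0, where Koszul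
relations of powers of variables suffice (`mem_range_of_exact_mod_X`, `exists_first_syzygy`,
`exists_second_syzygy`).

Degrees are compared through monomials divisible by no term of the binomials, each alone in its
degree (`eq_of_weight_eq_weight`). For q, c ≥ 2 this separates all degrees. For q = 1 the degrees of
X 3 ^ (c + 1) and X 2 ^ (b + 1) differ by (a - 1) n 1 + b n 2, and for c = 1 two first syzygies have
degrees differing by p n 0. -/

open Classical in
/-- The part of `v` consisting of the terms whose degree satisfies `P`. -/
def degreePart (n : Fin 4 → ℕ) {r : ℕ} (deg : Fin r → ℕ) (P : ℕ → Prop)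
    (v : Fin r → MvPolynomial (Fin 4) K) : Fin r → MvPolynomial (Fin 4) K := fun k =>
  ∑ u ∈ (v k).support, if P (Finsupp.weight n u + deg k) then monomial u (coeff u (v k)) else 0

open Classical in
theorem coeff_degreePart {r : ℕ} (deg : Fin r → ℕ) (P : ℕ → Prop)
    (v : Fin r → MvPolynomial (Fin 4) K) (k : Fin r) (u : Fin 4 →₀ ℕ) :
    coeff u (degreePart n deg P v k) =
      if P (Finsupp.weight n u + deg k) then coeff u (v k) else 0 := by
  rw [degreePart, coeff_sum, Finset.sum_eq_single u]
  · split_ifs <;> simp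
  · intro w _ hw
    split_ifs <;> simp [coeff_monomial, hw]
  · intro hu
    split_ifs <;> simp_all

theorem of_mem_support_degreePart {r : ℕ} {deg : Fin r → ℕ} {P : ℕ → Prop}
    {v : Fin r → MvPolynomial (Fin 4) K} {k : Fin r} {u : Fin 4 →₀ ℕ}
    (hu : u ∈ (degreePart n deg P v k).support) :
    P (Finsupp.weight n u + deg k) ∧ u ∈ (v k).support := by
  classical
  rw [mem_support_iff, coeff_degreePart] at hu
  split_ifs at hu with h
  · exact ⟨h, mem_support_iff.2 hu⟩
  · exact absurd rfl hu

theorem degreePart_eq_self {r : ℕ} {deg : Fin r → ℕ} {P : ℕ → Prop}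
    {v : Fin r → MvPolynomial (Fin 4) K}
    (hv : ∀ k, ∀ u ∈ (v k).support, P (Finsupp.weight n u + deg k)) :
    degreePart n deg P v = v := by
  classical
  funext k
  ext u
  rw [coeff_degreePart]
  split_ifs with h
  · rfl
  · by_contra hne
    exact h (hv k u (mem_support_iff.2 (Ne.symm hne)))

theorem linearMap_apply_eq_sum {r s : ℕ}
    (D : (Fin r → MvPolynomial (Fin 4) K) →ₗ[MvPolynomial (Fin 4) K]
      (Fin s → MvPolynomial (Fin 4) K)) (v : Fin r → MvPolynomial (Fin 4) K) (k : Fin s) :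
    D v k = ∑ j, v j * D (Pi.single j 1) k := by
  rw [LinearMap.pi_apply_eq_sum_univ D v]
  simp only [Finset.sum_apply, Pi.smul_apply, smul_eq_mul]
  refine Finset.sum_congr rfl fun j _ => ?_
  have : (fun i => if j = i then (1 : MvPolynomial (Fin 4) K) else 0) = Pi.single j 1 := by
    funext i
    simp [Pi.single_apply, eq_comm]
  rw [this]

/-- Each term of a matrix entry of a homogeneous map carries terms of total degree e to terms of
total degree e, so selecting degrees before or after the map is the same. -/
theorem map_degreePart {r s : ℕ} {degR : Fin r → ℕ} {degS : Fin s → ℕ}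
    {D : (Fin r → MvPolynomial (Fin 4) K) →ₗ[MvPolynomial (Fin 4) K]
      (Fin s → MvPolynomial (Fin 4) K)}
    (hD : ∀ j, IsHomogeneousVec n degS (D (Pi.single j 1)) (degR j)) (P : ℕ → Prop)
    (v : Fin r → MvPolynomial (Fin 4) K) :
    D (degreePart n degR P v) = degreePart n degS P (D v) := by
  classical
  funext k
  ext u
  rw [coeff_degreePart, linearMap_apply_eq_sum, linearMap_apply_eq_sum D v, coeff_sum,
    coeff_sum, ← Finset.sum_const_zero (s := (Finset.univ : Finset (Fin r))),
    ← Finset.sum_ite_irrel]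
  refine Finset.sum_congr rfl fun j _ => ?_
  rw [coeff_mul, coeff_mul, ← Finset.sum_const_zero (s := Finset.HasAntidiagonal.antidiagonal u),
    ← Finset.sum_ite_irrel]
  refine Finset.sum_congr rfl fun x hx => ?_
  rw [coeff_degreePart]
  by_cases h0 : coeff x.2 (D (Pi.single j 1) k) = 0
  · simp [h0]
  have h := hD j k x.2 (mem_support_iff.2 h0)
  have hu : Finsupp.weight n u = Finsupp.weight n x.1 + Finsupp.weight n x.2 := by
    rw [← map_add, Finset.HasAntidiagonal.mem_antidiagonal.1 hx]
  have : Finsupp.weight n x.1 + degR j = Finsupp.weight n u + degS k := by omega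
  rw [this]
  split_ifs <;> simp

theorem exists_homogeneous_preimage {r s : ℕ} {degR : Fin r → ℕ} {degS : Fin s → ℕ}
    {D : (Fin r → MvPolynomial (Fin 4) K) →ₗ[MvPolynomial (Fin 4) K]
      (Fin s → MvPolynomial (Fin 4) K)}
    (hD : ∀ j, IsHomogeneousVec n degS (D (Pi.single j 1)) (degR j))
    {y : Fin s → MvPolynomial (Fin 4) K} {e : ℕ} (hy : IsHomogeneousVec n degS y e)
    (hyD : y ∈ LinearMap.range D) : ∃ v, IsHomogeneousVec n degR v e ∧ D v = y := by
  obtain ⟨v, rfl⟩ := hyD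
  refine ⟨degreePart n degR (· = e) v, fun k u hu => (of_mem_support_degreePart hu).1, ?_⟩
  rw [map_degreePart hD]
  exact degreePart_eq_self hy

theorem isHomogeneousVec_map {r s : ℕ} {degR : Fin r → ℕ} {degS : Fin s → ℕ}
    {D : (Fin r → MvPolynomial (Fin 4) K) →ₗ[MvPolynomial (Fin 4) K]
      (Fin s → MvPolynomial (Fin 4) K)}
    (hD : ∀ j, IsHomogeneousVec n degS (D (Pi.single j 1)) (degR j))
    {v : Fin r → MvPolynomial (Fin 4) K} {e : ℕ} (hv : IsHomogeneousVec n degR v e) :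
    IsHomogeneousVec n degS (D v) e := by
  have h := map_degreePart hD (· = e) v
  rw [degreePart_eq_self (P := (· = e)) hv] at h
  intro k u hu
  rw [h] at hu
  exact (of_mem_support_degreePart hu).1

theorem X_dvd_iff_support {σ : Type*} {i : σ} {p : MvPolynomial σ K} :
    X i ∣ p ↔ ∀ u ∈ p.support, u i ≠ 0 := by
  rw [← Ideal.mem_span_singleton, ← Set.image_singleton (f := (X : σ → MvPolynomial σ K)),
    mem_ideal_span_X_image]
  simp

/-- Exactness of a graded complex of free modules follows from exactness modulo the variable
`X 0`, which has positive degree. -/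
theorem mem_range_of_exact_mod_X {r s t : ℕ} {degR : Fin r → ℕ} {degS : Fin s → ℕ}
    {D : (Fin r → MvPolynomial (Fin 4) K) →ₗ[MvPolynomial (Fin 4) K]
      (Fin s → MvPolynomial (Fin 4) K)}
    {E : (Fin s → MvPolynomial (Fin 4) K) →ₗ[MvPolynomial (Fin 4) K]
      (Fin t → MvPolynomial (Fin 4) K)}
    (hn : 0 < n 0) (hD : ∀ j, IsHomogeneousVec n degS (D (Pi.single j 1)) (degR j))
    (hED : ∀ w, E (D w) = 0)
    (hmod : ∀ v, E v = 0 → ∃ w, ∀ k, X 0 ∣ (v - D w) k)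
    (v : Fin s → MvPolynomial (Fin 4) K) (hv : E v = 0) : v ∈ LinearMap.range D := by
  -- Induction on a strict bound N for the degrees occurring in v: correcting v by the image of D
  -- leaves a multiple of X 0, and the quotient by X 0 satisfies a smaller bound because n 0 > 0.
  have key : ∀ N : ℕ, ∀ v, E v = 0 →
      (∀ k, ∀ u ∈ (v k).support, Finsupp.weight n u + degS k < N) → v ∈ LinearMap.range D := by
    intro N
    induction N with
    | zero =>
      intro v _ hN
      have : v = 0 := by
        funext k
        by_contra h
        obtain ⟨u, hu⟩ := support_nonempty.2 h
        exact absurd (hN k u hu) (Nat.not_lt_zero _)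
      exact this ▸ zero_mem _
    | succ N ih =>
      intro v hv hN
      obtain ⟨w, hw⟩ := hmod v hv
      -- The correction w may have terms of large degree; truncating it keeps the bound on the
      -- difference and does not change v.
      have hy : degreePart n degS (· < N + 1) (v - D w) =
          v - D (degreePart n degR (· < N + 1) w) := by
        rw [map_degreePart hD]
        nth_rewrite 2 [← degreePart_eq_self (v := v) (P := (· < N + 1)) hN]
        classical
        funext k
        ext u
        simp only [coeff_degreePart, Pi.sub_apply, coeff_sub]
        split_ifs <;> simp
      have hdvd : ∀ k, X 0 ∣ degreePart n degS (· < N + 1) (v - D w) k := fun k =>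
        X_dvd_iff_support.2 fun u hu =>
          X_dvd_iff_support.1 (hw k) u (of_mem_support_degreePart hu).2
      choose y' hy' using hdvd
      have hyX : v - D (degreePart n degR (· < N + 1) w) = (X 0 : MvPolynomial (Fin 4) K) • y' := by
        rw [← hy]; funext k; rw [hy' k]; rfl
      have hEy : E y' = 0 := by
        have : (X 0 : MvPolynomial (Fin 4) K) • E y' = 0 := by
          rw [← map_smul, ← hyX, map_sub, hv, hED, sub_zero]
        exact (smul_eq_zero.1 this).resolve_left (X_ne_zero _)
      have hmem : y' ∈ LinearMap.range D := by
        refine ih y' hEy fun k u hu => ?_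
        have hu' : u + Finsupp.single 0 1 ∈
            (degreePart n degS (· < N + 1) (v - D w) k).support := by
          rw [hy' k, mem_support_iff, add_comm, coeff_X_mul]
          exact mem_support_iff.1 hu
        have := (of_mem_support_degreePart hu').1
        rw [map_add, Finsupp.weight_single] at this
        simp only [smul_eq_mul, one_mul] at this
        omega
      rw [← sub_add_cancel v (D (degreePart n degR (· < N + 1) w)), hyX]
      exact add_mem (Submodule.smul_mem _ _ hmem) (LinearMap.mem_range_self _ _)
  refine key ((Finset.univ.sup fun k => (v k).support.sup
    fun u => Finsupp.weight n u + degS k) + 1) v hv fun k u hu => Nat.lt_succ_of_le ?_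
  exact (Finset.le_sup (f := fun u => Finsupp.weight n u + degS k) hu).trans
    (Finset.le_sup (f := fun k => (v k).support.sup fun u => Finsupp.weight n u + degS k)
      (Finset.mem_univ k))

end Restrict

/-! ### The augmentation -/

section Augmentation

variable {K : Type*} [Field K] {n : Fin 4 → ℕ}

theorem semigroupRing_coe_smul (p : MvPolynomial (Fin 4) K) (x : semigroupRing K n) :
    ((p • x : semigroupRing K n) : Polynomial K) = toricMap K n p * x := rfl

theorem toricMap_monomial (u : Fin 4 →₀ ℕ) (c : K) :
    toricMap K n (monomial u c) = Polynomial.monomial (Finsupp.weight n u) c := by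
  rw [toricMap, aeval_monomial, ← Polynomial.C_mul_X_pow_eq_monomial, Finsupp.weight_apply]
  congr 1
  simp only [Finsupp.prod, Finsupp.sum, ← pow_mul, smul_eq_mul]
  rw [Finset.prod_pow_eq_pow_sum]
  congr 1
  exact Finset.sum_congr rfl fun _ _ => mul_comm _ _

theorem coe_aug_apply {r : ℕ}
    (aug : (Fin r → MvPolynomial (Fin 4) K) →ₗ[MvPolynomial (Fin 4) K] semigroupRing K n)
    (v : Fin r → MvPolynomial (Fin 4) K) :
    (aug v : Polynomial K) = ∑ j, toricMap K n (v j) * (aug (Pi.single j 1) : Polynomial K) := by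
  rw [LinearMap.pi_apply_eq_sum_univ aug v, AddSubmonoidClass.coe_finsetSum]
  refine Finset.sum_congr rfl fun j _ => ?_
  rw [semigroupRing_coe_smul]
  congr 4
  funext i
  simp [Pi.single_apply, eq_comm]

theorem exists_homogeneous_preimage_aug {r : ℕ} {deg : Fin r → ℕ}
    {aug : (Fin r → MvPolynomial (Fin 4) K) →ₗ[MvPolynomial (Fin 4) K] semigroupRing K n}
    (haug : ∀ j, ∃ c : K, (aug (Pi.single j 1) : Polynomial K) = Polynomial.monomial (deg j) c)
    {y : semigroupRing K n} {e : ℕ} (hy : ∃ c : K, (y : Polynomial K) = Polynomial.monomial e c)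
    (hyr : ∃ v, aug v = y) : ∃ v, IsHomogeneousVec n deg v e ∧ aug v = y := by
  classical
  obtain ⟨v, rfl⟩ := hyr
  obtain ⟨c, hc⟩ := hy
  choose a ha using haug
  -- The index set s may exceed the support, so that v and its degree part can be summed over the
  -- same set.
  have hcoeff : ∀ (p : MvPolynomial (Fin 4) K) (j : Fin r) (m : ℕ) (s : Finset (Fin 4 →₀ ℕ)),
      p.support ⊆ s → (toricMap K n p * Polynomial.monomial (deg j) (a j)).coeff m =
        ∑ u ∈ s, if Finsupp.weight n u + deg j = m then coeff u p * a j else 0 := by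
    intro p j m s hs
    have hp : p = ∑ u ∈ s, monomial u (coeff u p) := by
      conv_lhs => rw [p.as_sum]
      exact Finset.sum_subset hs fun u _ hu => by rw [notMem_support_iff.1 hu, monomial_zero]
    conv_lhs => rw [hp]
    simp only [map_sum, Finset.sum_mul, toricMap_monomial, Polynomial.monomial_mul_monomial,
      Polynomial.finsetSum_coeff, Polynomial.coeff_monomial]
  refine ⟨degreePart n deg (· = e) v, fun k u hu => (of_mem_support_degreePart hu).1, ?_⟩
  apply Subtype.ext
  ext m
  have h1 : (aug (degreePart n deg (· = e) v) : Polynomial K).coeff m =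
      if m = e then (aug v : Polynomial K).coeff m else 0 := by
    rw [coe_aug_apply, coe_aug_apply aug v, Polynomial.finsetSum_coeff, Polynomial.finsetSum_coeff,
      ← Finset.sum_const_zero (s := (Finset.univ : Finset (Fin r))), ← Finset.sum_ite_irrel]
    refine Finset.sum_congr rfl fun j _ => ?_
    rw [ha, hcoeff _ _ _ (v j).support fun u hu => (of_mem_support_degreePart hu).2,
      hcoeff _ _ _ _ subset_rfl, ← Finset.sum_const_zero (s := (v j).support),
      ← Finset.sum_ite_irrel]
    refine Finset.sum_congr rfl fun u _ => ?_
    rw [coeff_degreePart]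
    by_cases h : Finsupp.weight n u + deg j = m
    · subst h
      by_cases h' : Finsupp.weight n u + deg j = e <;> simp [h']
    · simp [h]
  rw [h1, hc, Polynomial.coeff_monomial]
  by_cases h : m = e
  · simp [h]
  · simp [h, Ne.symm h]

end Augmentation

/-! ### Comparison of minimal resolutions -/

section Comparison

variable {K : Type*} [Field K] {n : Fin 4 → ℕ}

theorem weight_eq_zero_iff (hn : ∀ i, 0 < n i) (u : Fin 4 →₀ ℕ) :
    Finsupp.weight n u = 0 ↔ u = 0 := by
  have := Finsupp.nonTorsionWeight_of (R := ℕ) (w := n) fun i => (hn i).ne'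
  exact Finsupp.weight_eq_zero_iff_eq_zero n

/-- The map of free modules sending the `j`-th basis element to `c j` times the `σ j`-th one. -/
def monomialMap {r s : ℕ} (σ : Fin r ≃ Fin s) (c : Fin r → K) :
    (Fin r → MvPolynomial (Fin 4) K) →ₗ[MvPolynomial (Fin 4) K]
      (Fin s → MvPolynomial (Fin 4) K) where
  toFun v k := C (c (σ.symm k)) * v (σ.symm k)
  map_add' v w := by funext k; simp [mul_add]
  map_smul' a v := by funext k; simp [mul_left_comm]

theorem monomialMap_single {r s : ℕ} (σ : Fin r ≃ Fin s) (c : Fin r → K) (j : Fin r) :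
    monomialMap σ c (Pi.single j 1) = Pi.single (σ j) (C (c j)) := by
  funext k
  obtain ⟨l, rfl⟩ := σ.surjective k
  by_cases h : l = j
  · subst h; simp [monomialMap]
  · simp [monomialMap, h]

theorem monomialMap_symm_apply {r s : ℕ} (σ : Fin r ≃ Fin s) {c : Fin r → K} (hc : ∀ j, c j ≠ 0)
    (v : Fin r → MvPolynomial (Fin 4) K) :
    monomialMap σ.symm (fun k => (c (σ.symm k))⁻¹) (monomialMap σ c v) = v := by
  funext k
  simp [monomialMap, ← mul_assoc, ← C_mul, hc]

theorem monomialMap_apply_symm {r s : ℕ} (σ : Fin r ≃ Fin s) {c : Fin r → K} (hc : ∀ j, c j ≠ 0)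
    (v : Fin s → MvPolynomial (Fin 4) K) :
    monomialMap σ c (monomialMap σ.symm (fun k => (c (σ.symm k))⁻¹) v) = v := by
  funext k
  simp [monomialMap, ← mul_assoc, ← C_mul, hc]

theorem isHomogeneousVec_monomialMap {r s : ℕ} {degR : Fin r → ℕ} {degS : Fin s → ℕ}
    (σ : Fin r ≃ Fin s) (c : Fin r → K) (hσ : ∀ j, degS (σ j) = degR j)
    {v : Fin r → MvPolynomial (Fin 4) K} {e : ℕ} (hv : IsHomogeneousVec n degR v e) :
    IsHomogeneousVec n degS (monomialMap σ c v) e := by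
  intro k u hu
  obtain ⟨l, rfl⟩ := σ.surjective k
  rw [hσ]
  refine hv l u (mem_support_iff.2 fun h => mem_support_iff.1 hu ?_)
  simp [monomialMap, coeff_C_mul, h]

theorem deg_eq_of_constantCoeff_ne_zero {s : ℕ} {deg : Fin s → ℕ}
    {v : Fin s → MvPolynomial (Fin 4) K}
    {e : ℕ} (hv : IsHomogeneousVec n deg v e) {k : Fin s} (h : constantCoeff (v k) ≠ 0) :
    deg k = e := by
  have := hv k 0 (mem_support_iff.2 h)
  simpa using this

/-- Lifting from one cover to the other and back is the identity up to the kernel of p, whose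
vectors have no constant terms. Hence the matrices of constant terms multiply to the identity over
K. -/
theorem sum_constantCoeff_mul_constantCoeff {r s : ℕ} {M : Type*} [AddCommGroup M]
    [Module (MvPolynomial (Fin 4) K) M]
    {p : (Fin r → MvPolynomial (Fin 4) K) →ₗ[MvPolynomial (Fin 4) K] M}
    {q : (Fin s → MvPolynomial (Fin 4) K) →ₗ[MvPolynomial (Fin 4) K] M}
    (hp : ∀ v, p v = 0 → ∀ k, constantCoeff (v k) = 0)
    {v : Fin r → Fin s → MvPolynomial (Fin 4) K} (hv : ∀ j, q (v j) = p (Pi.single j 1))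
    {w : Fin s → Fin r → MvPolynomial (Fin 4) K} (hw : ∀ k, p (w k) = q (Pi.single k 1))
    (j j' : Fin r) :
    ∑ k, constantCoeff (v j k) * constantCoeff (w k j') = if j' = j then 1 else 0 := by
  have h0 : p (∑ k, v j k • w k - Pi.single j 1) = 0 := by
    rw [map_sub, map_sum, ← hv j, sub_eq_zero]
    simp only [map_smul, hw]
    rw [LinearMap.pi_apply_eq_sum_univ q (v j)]
    refine Finset.sum_congr rfl fun k _ => ?_
    have : (fun i => if k = i then (1 : MvPolynomial (Fin 4) K) else 0) = Pi.single k 1 := by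
      funext i
      simp [Pi.single_apply, eq_comm]
    rw [this]
  have h1 := hp _ h0 j'
  simp only [Pi.sub_apply, Finset.sum_apply, Pi.smul_apply, smul_eq_mul, map_sub, map_sum,
    map_mul, sub_eq_zero] at h1
  rw [h1, Pi.single_apply]
  split_ifs <;> simp

/-- Two minimal graded covers of the same module agree up to a monomial change of basis, if no two
degrees of the first one differ by an element of the semigroup. -/
theorem exists_monomialMap {r s : ℕ} {M : Type*} [AddCommGroup M]
    [Module (MvPolynomial (Fin 4) K) M] (hn : ∀ i, 0 < n i)
    {degF : Fin r → ℕ} {degG : Fin s → ℕ}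
    {p : (Fin r → MvPolynomial (Fin 4) K) →ₗ[MvPolynomial (Fin 4) K] M}
    {q : (Fin s → MvPolynomial (Fin 4) K) →ₗ[MvPolynomial (Fin 4) K] M}
    (hF : ∀ j j', j ≠ j' → ∀ u : Fin 4 →₀ ℕ, degF j ≠ Finsupp.weight n u + degF j')
    (hp : ∀ v, p v = 0 → ∀ k, constantCoeff (v k) = 0)
    (hq : ∀ v, q v = 0 → ∀ k, constantCoeff (v k) = 0)
    (hpq : ∀ j, ∃ v, IsHomogeneousVec n degG v (degF j) ∧ q v = p (Pi.single j 1))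
    (hqp : ∀ k, ∃ w, IsHomogeneousVec n degF w (degG k) ∧ p w = q (Pi.single k 1)) :
    ∃ (σ : Fin r ≃ Fin s) (c : Fin r → K), (∀ j, c j ≠ 0) ∧ (∀ j, degG (σ j) = degF j) ∧
      q ∘ₗ monomialMap σ c = p := by
  choose v hvdeg hv using hpq
  choose w hwdeg hw using hqp
  have hVW := sum_constantCoeff_mul_constantCoeff hp hv hw
  have hWV := sum_constantCoeff_mul_constantCoeff hq hw hv
  have hinj : ∀ j j', degF j = degF j' → j = j' := fun j j' h => by
    by_contra hne
    exact hF j j' hne 0 (by simp [h])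
  have hσ : ∀ j, ∃ k, constantCoeff (v j k) * constantCoeff (w k j) ≠ 0 := fun j => by
    obtain ⟨k, _, hk⟩ := Finset.exists_ne_zero_of_sum_ne_zero
      (f := fun k => constantCoeff (v j k) * constantCoeff (w k j)) (s := Finset.univ)
      (by rw [hVW j j, if_pos rfl]; exact one_ne_zero)
    exact ⟨k, hk⟩
  have hτ : ∀ k, ∃ j, constantCoeff (w k j) * constantCoeff (v j k) ≠ 0 := fun k => by
    obtain ⟨j, _, hj⟩ := Finset.exists_ne_zero_of_sum_ne_zero
      (f := fun j => constantCoeff (w k j) * constantCoeff (v j k)) (s := Finset.univ)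
      (by rw [hWV k k, if_pos rfl]; exact one_ne_zero)
    exact ⟨j, hj⟩
  choose σ hσ using hσ
  choose τ hτ using hτ
  have hσdeg : ∀ j, degG (σ j) = degF j := fun j =>
    deg_eq_of_constantCoeff_ne_zero (hvdeg j) (left_ne_zero_of_mul (hσ j))
  have hτdeg : ∀ k, degF (τ k) = degG k := fun k =>
    deg_eq_of_constantCoeff_ne_zero (hwdeg k) (left_ne_zero_of_mul (hτ k))
  have hτσ : ∀ j, τ (σ j) = j := fun j => hinj _ _ ((hτdeg _).trans (hσdeg j))
  -- In row k of the second product only the index τ k can contribute, since the degrees `degF` are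
  -- distinct; its term is nonzero, so the entry at σ (τ k) must be diagonal.
  have hστ : ∀ k, σ (τ k) = k := fun k => by
    by_contra hne
    have h := hWV k (σ (τ k))
    rw [if_neg hne, Finset.sum_eq_single (τ k)] at h
    · exact mul_ne_zero (left_ne_zero_of_mul (hτ k)) (left_ne_zero_of_mul (hσ (τ k))) h
    · intro j _ hj
      by_contra h0
      exact hj (hinj _ _ ((deg_eq_of_constantCoeff_ne_zero (hwdeg k)
        (left_ne_zero_of_mul h0)).trans (hτdeg k).symm))
    · simp
  refine ⟨⟨σ, τ, hτσ, hστ⟩, fun j => constantCoeff (v j (σ j)),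
    fun j => left_ne_zero_of_mul (hσ j), hσdeg, ?_⟩
  refine LinearMap.pi_ext' fun j => LinearMap.ext_ring ?_
  simp only [LinearMap.comp_apply, LinearMap.single_apply, monomialMap_single, Equiv.coe_fn_mk]
  rw [← hv j]
  congr 1
  funext k
  -- At σ j the degrees agree, so only the constant term survives; elsewhere a nonzero term would
  -- express a difference of two degrees in `degF` as an element of the semigroup.
  by_cases hk : k = σ j
  · subst hk
    rw [Pi.single_eq_same]
    ext u
    rw [coeff_C]
    split_ifs with hu
    · rw [← hu]; rfl
    · by_contra hne
      have := hvdeg j (σ j) u (mem_support_iff.2 (Ne.symm hne))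
      rw [hσdeg, Nat.add_eq_right, weight_eq_zero_iff hn] at this
      exact hu this.symm
  · rw [Pi.single_eq_of_ne hk]
    by_contra hne
    obtain ⟨u, hu⟩ := support_nonempty.2 (Ne.symm hne)
    have h := hvdeg j k u hu
    rw [← hτdeg k] at h
    by_cases hj : j = τ k
    · exact hk (by rw [hj, hστ])
    · exact hF j (τ k) hj u h.symm

namespace MinimalGradedResolution

theorem constantCoeff_d (G : MinimalGradedResolution K n) (i : ℕ)
    (w : Fin (G.rank (i + 1)) → MvPolynomial (Fin 4) K) (k : Fin (G.rank i)) :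
    constantCoeff (G.d i w k) = 0 := by
  rw [linearMap_apply_eq_sum, map_sum]
  exact Finset.sum_eq_zero fun j _ => by rw [map_mul, G.minimal, mul_zero]

theorem constantCoeff_of_d_eq_zero (G : MinimalGradedResolution K n) (i : ℕ)
    (w : Fin (G.rank (i + 1)) → MvPolynomial (Fin 4) K) (hw : G.d i w = 0)
    (k : Fin (G.rank (i + 1))) : constantCoeff (w k) = 0 := by
  obtain ⟨x, rfl⟩ := (G.exact_succ i w).1 hw
  exact G.constantCoeff_d _ x k

theorem constantCoeff_of_aug_eq_zero (G : MinimalGradedResolution K n)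
    (w : Fin (G.rank 0) → MvPolynomial (Fin 4) K) (hw : G.aug w = 0)
    (k : Fin (G.rank 0)) : constantCoeff (w k) = 0 := by
  obtain ⟨x, rfl⟩ := (G.exact_zero w).1 hw
  exact G.constantCoeff_d _ x k

/-- `f` is a homogeneous monomial isomorphism between the terms in homological degree `i` of two
resolutions, matching the images of the differentials. -/
def IsMatching (F G : MinimalGradedResolution K n) (i : ℕ)
    (f : (Fin (F.rank i) → MvPolynomial (Fin 4) K) →ₗ[MvPolynomial (Fin 4) K]
        (Fin (G.rank i) → MvPolynomial (Fin 4) K)) : Prop :=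
  (∃ (σ : Fin (F.rank i) ≃ Fin (G.rank i)) (c : Fin (F.rank i) → K), (∀ j, c j ≠ 0) ∧
    (∀ j, G.deg i (σ j) = F.deg i j) ∧ f = monomialMap σ c) ∧
  ∀ v, v ∈ LinearMap.range (F.d i) ↔ f v ∈ LinearMap.range (G.d i)

theorem exists_isMatching_zero (hn : ∀ i, 0 < n i) (F G : MinimalGradedResolution K n)
    (hF : ∀ j j', j ≠ j' → ∀ u : Fin 4 →₀ ℕ, F.deg 0 j ≠ Finsupp.weight n u + F.deg 0 j') :
    ∃ f, IsMatching F G 0 f := by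
  obtain ⟨σ, c, hc, hdeg, h⟩ := exists_monomialMap hn (p := F.aug) (q := G.aug)
    (degG := G.deg 0) hF
    F.constantCoeff_of_aug_eq_zero G.constantCoeff_of_aug_eq_zero
    (fun j => exists_homogeneous_preimage_aug G.aug_homogeneous (F.aug_homogeneous j)
      (G.aug_surjective _))
    (fun k => exists_homogeneous_preimage_aug F.aug_homogeneous (G.aug_homogeneous k)
      (F.aug_surjective _))
  refine ⟨monomialMap σ c, ⟨σ, c, hc, hdeg, rfl⟩, fun v => ?_⟩
  have h1 := F.exact_zero v
  have h2 := G.exact_zero (monomialMap σ c v)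
  rw [← h, LinearMap.comp_apply] at h1
  exact h1.symm.trans h2

/-- After the matching in position i, f ∘ F.d i and G.d i cover the same submodule of G. By
exactness and minimality their kernels have no constant terms, so `exists_monomialMap` applies;
equality of the kernels carries the matching on. -/
theorem IsMatching.exists_succ (hn : ∀ i, 0 < n i) {F G : MinimalGradedResolution K n} {i : ℕ}
    (hF : ∀ j j', j ≠ j' → ∀ u : Fin 4 →₀ ℕ,
      F.deg (i + 1) j ≠ Finsupp.weight n u + F.deg (i + 1) j')
    {f : (Fin (F.rank i) → MvPolynomial (Fin 4) K) →ₗ[MvPolynomial (Fin 4) K]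
        (Fin (G.rank i) → MvPolynomial (Fin 4) K)} (hf : IsMatching F G i f) :
    ∃ f', IsMatching F G (i + 1) f' ∧ f ∘ₗ F.d i = G.d i ∘ₗ f' := by
  obtain ⟨⟨τ, b, hb, hτdeg, rfl⟩, hfr⟩ := hf
  have hinj : Function.Injective (monomialMap (K := K) τ b) :=
    Function.LeftInverse.injective (monomialMap_symm_apply τ hb)
  have hzero : ∀ v, monomialMap τ b (F.d i v) = 0 ↔ F.d i v = 0 := fun v =>
    map_eq_zero_iff _ hinj
  obtain ⟨σ, c, hc, hdeg, h⟩ := exists_monomialMap hn (p := monomialMap τ b ∘ₗ F.d i)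
    (q := G.d i) (degG := G.deg (i + 1)) hF
    (fun v hv => F.constantCoeff_of_d_eq_zero i v ((hzero v).1 hv))
    (G.constantCoeff_of_d_eq_zero i)
    (fun j => exists_homogeneous_preimage (G.d_homogeneous i)
      (isHomogeneousVec_monomialMap τ b hτdeg (F.d_homogeneous i j))
      ((hfr _).1 (LinearMap.mem_range_self _ _)))
    (fun k => by
      have hy := monomialMap_apply_symm τ hb (G.d i (Pi.single k 1))
      obtain ⟨w, hw, hwy⟩ := exists_homogeneous_preimage (F.d_homogeneous i)
        (isHomogeneousVec_monomialMap (degS := F.deg i) τ.symm (fun k => (b (τ.symm k))⁻¹)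
          (fun k => by rw [← hτdeg, Equiv.apply_symm_apply]) (G.d_homogeneous i k))
        ((hfr _).2 (by rw [hy]; exact LinearMap.mem_range_self _ _))
      exact ⟨w, hw, by rw [LinearMap.comp_apply, hwy, hy]⟩)
  refine ⟨monomialMap σ c, ⟨⟨σ, c, hc, hdeg, rfl⟩, fun v => ?_⟩, h.symm⟩
  have h1 := F.exact_succ i v
  have h2 := G.exact_succ i (monomialMap σ c v)
  rw [← hzero v, ← LinearMap.comp_apply, ← h, LinearMap.comp_apply] at h1
  exact h1.symm.trans h2

/-- A minimal graded free resolution is strongly indispensable as soon as no two degrees of basis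
elements in the same homological degree differ by an element of the semigroup. -/
theorem stronglyIndispensable_of_deg (hn : ∀ i, 0 < n i) (F : MinimalGradedResolution K n)
    (hF : ∀ i j j', j ≠ j' → ∀ u : Fin 4 →₀ ℕ, F.deg i j ≠ Finsupp.weight n u + F.deg i j') :
    F.StronglyIndispensable := by
  intro G
  choose next hnext hcomm using fun (i : ℕ) (f : {f // IsMatching F G i f}) =>
    f.2.exists_succ hn (hF (i + 1))
  obtain ⟨f₀, hf₀⟩ := exists_isMatching_zero hn F G (hF 0)
  let f : ∀ i, {f // IsMatching F G i f} := fun i =>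
    Nat.rec ⟨f₀, hf₀⟩ (fun i f => ⟨next i f, hnext i f⟩) i
  refine ⟨fun i => (f i).1, fun i => hcomm i (f i), fun i => ?_, fun i j => ?_⟩
  · obtain ⟨⟨σ, c, hc, -, h⟩, -⟩ := (f i).2
    simp only [h]
    exact Function.LeftInverse.injective (monomialMap_symm_apply σ hc)
  · obtain ⟨⟨σ, c, hc, hdeg, h⟩, -⟩ := (f i).2
    exact ⟨σ j, c j, hc j, hdeg j, by simp only [h, monomialMap_single]⟩

end MinimalGradedResolution

end Comparison

/-! ### Changes of bases and dispensability -/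

section ChangeOfBasis

variable {K : Type*} [Field K] {n : Fin 4 → ℕ}

/-- The automorphism of a free module adding `X ^ u` times the `k`-th basis element to the `j`-th
basis element. -/
def transvectionEquiv {r : ℕ} (u : Fin 4 →₀ ℕ) {j k : Fin r} (hjk : j ≠ k) :
    (Fin r → MvPolynomial (Fin 4) K) ≃ₗ[MvPolynomial (Fin 4) K]
      (Fin r → MvPolynomial (Fin 4) K) where
  toFun v := v + Pi.single k (v j * monomial u 1)
  map_add' v w := by
    rw [Pi.add_apply, add_mul, Pi.single_add]; abel
  map_smul' a v := by
    funext l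
    by_cases h : l = k
    · subst h; simp; ring
    · simp [h]
  invFun v := v - Pi.single k (v j * monomial u 1)
  left_inv v := by simp [hjk]
  right_inv v := by simp [hjk]

theorem isHomogeneousVec_single {r : ℕ} (deg : Fin r → ℕ) (l : Fin r) (u : Fin 4 →₀ ℕ) (c : K) :
    IsHomogeneousVec n deg (Pi.single l (monomial u c)) (Finsupp.weight n u + deg l) := by
  intro k w hw
  by_cases h : k = l
  · subst h
    rw [Pi.single_eq_same] at hw
    rw [Finset.mem_singleton.1 (support_monomial_subset hw)]
  · simp [Pi.single_eq_of_ne h] at hw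

theorem IsHomogeneousVec.add {r : ℕ} {deg : Fin r → ℕ} {v w : Fin r → MvPolynomial (Fin 4) K}
    {e : ℕ} (hv : IsHomogeneousVec n deg v e) (hw : IsHomogeneousVec n deg w e) :
    IsHomogeneousVec n deg (v + w) e := by
  classical
  intro k u hu
  rcases Finset.mem_union.1 (support_add hu) with h | h
  · exact hv k u h
  · exact hw k u h

theorem IsHomogeneousVec.neg {r : ℕ} {deg : Fin r → ℕ} {v : Fin r → MvPolynomial (Fin 4) K}
    {e : ℕ} (hv : IsHomogeneousVec n deg v e) : IsHomogeneousVec n deg (-v) e := by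
  intro k u hu
  rw [Pi.neg_apply, support_neg] at hu
  exact hv k u hu

theorem isHomogeneousVec_single_one {r : ℕ} (deg : Fin r → ℕ) (l : Fin r) :
    IsHomogeneousVec n deg (Pi.single l (1 : MvPolynomial (Fin 4) K)) (deg l) := by
  simpa using isHomogeneousVec_single (n := n) deg l 0 (1 : K)

theorem isHomogeneousVec_transvection_aux {r : ℕ} {deg : Fin r → ℕ} {u : Fin 4 →₀ ℕ}
    {j k : Fin r} (h : deg j = Finsupp.weight n u + deg k) (l : Fin r) :
    IsHomogeneousVec n deg
      (Pi.single k ((Pi.single l 1 : Fin r → MvPolynomial (Fin 4) K) j * monomial u 1))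
      (deg l) := by
  by_cases hl : j = l
  · subst hl
    simpa [h] using isHomogeneousVec_single (n := n) deg k u (1 : K)
  · rw [Pi.single_eq_of_ne hl, zero_mul, Pi.single_zero]
    intro k w hw
    simp at hw

theorem isHomogeneousVec_transvectionEquiv {r : ℕ} {deg : Fin r → ℕ} {u : Fin 4 →₀ ℕ}
    {j k : Fin r} (hjk : j ≠ k) (h : deg j = Finsupp.weight n u + deg k) (l : Fin r) :
    IsHomogeneousVec n deg (transvectionEquiv (K := K) u hjk (Pi.single l 1)) (deg l) :=
  (isHomogeneousVec_single_one deg l).add (isHomogeneousVec_transvection_aux h l)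

theorem isHomogeneousVec_transvectionEquiv_symm {r : ℕ} {deg : Fin r → ℕ} {u : Fin 4 →₀ ℕ}
    {j k : Fin r} (hjk : j ≠ k) (h : deg j = Finsupp.weight n u + deg k) (l : Fin r) :
    IsHomogeneousVec n deg ((transvectionEquiv (K := K) u hjk).symm (Pi.single l 1)) (deg l) := by
  have := (isHomogeneousVec_single_one (n := n) (K := K) deg l).add
    (isHomogeneousVec_transvection_aux h l).neg
  rwa [← sub_eq_add_neg] at this

namespace MinimalGradedResolution

/-- Transport of a resolution along homogeneous automorphisms of its free modules. -/
def changeBasis (R : MinimalGradedResolution K n)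
    (τ : ∀ i, (Fin (R.rank i) → MvPolynomial (Fin 4) K) ≃ₗ[MvPolynomial (Fin 4) K]
      (Fin (R.rank i) → MvPolynomial (Fin 4) K))
    (hτ : ∀ i j, IsHomogeneousVec n (R.deg i) (τ i (Pi.single j 1)) (R.deg i j))
    (hτ' : ∀ i j, IsHomogeneousVec n (R.deg i) ((τ i).symm (Pi.single j 1)) (R.deg i j)) :
    MinimalGradedResolution K n where
  rank := R.rank
  deg := R.deg
  d i := (τ i).symm.toLinearMap ∘ₗ R.d i ∘ₗ (τ (i + 1)).toLinearMap
  aug := R.aug ∘ₗ (τ 0).toLinearMap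
  d_homogeneous i j :=
    isHomogeneousVec_map (D := (τ i).symm.toLinearMap) (hτ' i)
      (isHomogeneousVec_map (R.d_homogeneous i) (hτ (i + 1) j))
  aug_homogeneous j := by
    classical
    choose a ha using R.aug_homogeneous
    have hterm : ∀ k, ∃ c : K, toricMap K n (τ 0 (Pi.single j 1) k) *
        (R.aug (Pi.single k 1) : Polynomial K) = Polynomial.monomial (R.deg 0 j) c := fun k => by
      refine ⟨∑ u ∈ (τ 0 (Pi.single j 1) k).support, coeff u (τ 0 (Pi.single j 1) k) * a k, ?_⟩
      conv_lhs => rw [(τ 0 (Pi.single j 1) k).as_sum]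
      rw [map_sum, map_sum, Finset.sum_mul]
      refine Finset.sum_congr rfl fun u hu => ?_
      rw [toricMap_monomial, ha, Polynomial.monomial_mul_monomial, hτ 0 j k u hu]
    choose c hc using hterm
    refine ⟨∑ k, c k, ?_⟩
    rw [LinearMap.comp_apply, coe_aug_apply, map_sum]
    exact Finset.sum_congr rfl fun k _ => hc k
  aug_surjective := R.aug_surjective.comp (τ 0).surjective
  exact_zero v := by
    refine (R.exact_zero (τ 0 v)).trans ⟨?_, ?_⟩
    · rintro ⟨w, hw⟩
      exact ⟨(τ 1).symm w, by simp [hw]⟩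
    · rintro ⟨w, rfl⟩
      exact ⟨τ 1 w, by simp⟩
  exact_succ i v := by
    have h := R.exact_succ i (τ (i + 1) v)
    rw [LinearMap.comp_apply, LinearEquiv.coe_coe, LinearEquiv.map_eq_zero_iff]
    refine h.trans ⟨?_, ?_⟩
    · rintro ⟨w, hw⟩
      exact ⟨(τ (i + 2)).symm w, by simp [hw]⟩
    · rintro ⟨w, rfl⟩
      exact ⟨τ (i + 2) w, by simp⟩
  minimal i j k := by
    rw [LinearMap.comp_apply, linearMap_apply_eq_sum, map_sum]
    exact Finset.sum_eq_zero fun l _ => by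
      rw [map_mul, LinearMap.comp_apply, R.constantCoeff_d, zero_mul]

/-- The maps from the definition of strong indispensability. -/
structure IsEmbedding (F G : MinimalGradedResolution K n)
    (f : ∀ i, (Fin (F.rank i) → MvPolynomial (Fin 4) K) →ₗ[MvPolynomial (Fin 4) K]
        (Fin (G.rank i) → MvPolynomial (Fin 4) K)) : Prop where
  comm : ∀ i, f i ∘ₗ F.d i = G.d i ∘ₗ f (i + 1)
  inj : ∀ i, Function.Injective (f i)
  map_basis : ∀ i j, ∃ k : Fin (G.rank i), ∃ c : K, c ≠ 0 ∧ f i (Pi.single j 1) = Pi.single k (C c)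

variable {F R : MinimalGradedResolution K n}
  {f : ∀ i, (Fin (F.rank i) → MvPolynomial (Fin 4) K) →ₗ[MvPolynomial (Fin 4) K]
        (Fin (R.rank i) → MvPolynomial (Fin 4) K)}

theorem nonempty_fin_rank_zero (F : MinimalGradedResolution K n) : Nonempty (Fin (F.rank 0)) := by
  by_contra h
  rw [not_nonempty_iff] at h
  obtain ⟨v, hv⟩ := F.aug_surjective 1
  rw [Subsingleton.elim v 0, map_zero] at hv
  exact zero_ne_one hv

/-- In rank one the augmentation is multiplication by the image of the generator, which is nonzero
in the domain K[t] because 1 is attained. -/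
theorem aug_eq_zero_iff (F : MinimalGradedResolution K n) [Subsingleton (Fin (F.rank 0))]
    (j : Fin (F.rank 0)) (v : Fin (F.rank 0) → MvPolynomial (Fin 4) K) :
    F.aug v = 0 ↔ toricMap K n (v j) = 0 := by
  have hsum : ∀ v, (F.aug v : Polynomial K) =
      toricMap K n (v j) * (F.aug (Pi.single j 1) : Polynomial K) := fun v => by
    rw [coe_aug_apply, Fintype.sum_subsingleton _ j]
  have hne : (F.aug (Pi.single j 1) : Polynomial K) ≠ 0 := fun h => by
    obtain ⟨w, hw⟩ := F.aug_surjective 1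
    have := hsum w
    rw [h, mul_zero, hw] at this
    exact one_ne_zero this
  rw [← Subtype.coe_inj, hsum, ZeroMemClass.coe_zero, mul_eq_zero, or_iff_left hne]

theorem IsEmbedding.subsingleton_zero (hf : IsEmbedding F R f) [Subsingleton (Fin (R.rank 0))] :
    Subsingleton (Fin (F.rank 0)) := by
  refine ⟨fun j j' => ?_⟩
  obtain ⟨k, c, hc, h⟩ := hf.map_basis 0 j
  obtain ⟨k', c', hc', h'⟩ := hf.map_basis 0 j'
  obtain rfl := Subsingleton.elim k k'
  have : (C c' : MvPolynomial (Fin 4) K) • (Pi.single j 1 : Fin (F.rank 0) → _) =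
      (C c : MvPolynomial (Fin 4) K) • Pi.single j' 1 := by
    apply hf.inj 0
    rw [map_smul, map_smul, h, h', ← Pi.single_smul, ← Pi.single_smul, smul_eq_mul, smul_eq_mul,
      mul_comm]
  by_contra hne
  have h1 := congrFun this j
  simp [hne, hc'] at h1

/-- A boundary of R lifts through the surjection f i to a cycle of F, by injectivity one step below
or by `aug_eq_zero_iff` at the start; exactness of F makes it a boundary. -/
theorem IsEmbedding.exists_map_d_eq (hf : IsEmbedding F R f) [Subsingleton (Fin (R.rank 0))]
    (i : ℕ) (hs : Function.Surjective (f i)) (w : Fin (R.rank (i + 1)) → MvPolynomial (Fin 4) K) :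
    ∃ x, R.d i (f (i + 1) x) = R.d i w := by
  obtain ⟨y, hy⟩ := hs (R.d i w)
  have : y ∈ Set.range (F.d i) := by
    cases i with
    | zero =>
      have := hf.subsingleton_zero
      obtain ⟨j⟩ := F.nonempty_fin_rank_zero
      obtain ⟨k, c, hc, h⟩ := hf.map_basis 0 j
      refine (F.exact_zero y).1 ((F.aug_eq_zero_iff j y).2 ?_)
      have h0 := (R.aug_eq_zero_iff k (R.d 0 w)).1 ((R.exact_zero _).2 ⟨w, rfl⟩)
      rw [← hy, linearMap_apply_eq_sum, Fintype.sum_subsingleton _ j, h, Pi.single_eq_same,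
        map_mul, mul_eq_zero] at h0
      refine h0.resolve_right fun h1 => hc ?_
      rwa [C_apply, toricMap_monomial, Polynomial.monomial_eq_zero_iff] at h1
    | succ i =>
      refine (F.exact_succ i y).1 (hf.inj i ?_)
      rw [map_zero, ← LinearMap.comp_apply, hf.comm, LinearMap.comp_apply, hy]
      exact (R.exact_succ i _).2 ⟨w, rfl⟩
  obtain ⟨x, rfl⟩ := this
  exact ⟨x, by rw [← hy, ← LinearMap.comp_apply, ← hf.comm, LinearMap.comp_apply]⟩

theorem surjective_of_single_mem {r s : ℕ}
    {g : (Fin r → MvPolynomial (Fin 4) K) →ₗ[MvPolynomial (Fin 4) K]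
      (Fin s → MvPolynomial (Fin 4) K)}
    (h : ∀ k : Fin s, ∃ j, ∃ c : K, c ≠ 0 ∧ g (Pi.single j 1) = Pi.single k (C c)) :
    Function.Surjective g := by
  intro w
  choose j c hc hj using h
  refine ⟨∑ k, (w k * C (c k)⁻¹) • Pi.single (j k) 1, ?_⟩
  rw [map_sum]
  simp only [map_smul, hj]
  simp only [← Pi.single_smul, smul_eq_mul, mul_assoc, ← C_mul]
  simp only [inv_mul_cancel₀ (hc _), C_1, mul_one]
  exact Finset.univ_sum_single w

/-- If the k-th basis element were missed, its boundary would still be that of some f x with zero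
k-th coordinate. Their difference would be a cycle with a nonzero constant term, against minimality.
-/
theorem IsEmbedding.exists_basis (hf : IsEmbedding F R f) [Subsingleton (Fin (R.rank 0))]
    (i : ℕ) (k : Fin (R.rank i)) :
    ∃ j, ∃ c : K, c ≠ 0 ∧ f i (Pi.single j 1) = Pi.single k (C c) := by
  induction i with
  | zero =>
    obtain ⟨j⟩ := F.nonempty_fin_rank_zero
    obtain ⟨k', c, hc, h⟩ := hf.map_basis 0 j
    exact ⟨j, c, hc, Subsingleton.elim k' k ▸ h⟩
  | succ i ih =>
    obtain ⟨x, hx⟩ := hf.exists_map_d_eq i (surjective_of_single_mem ih) (Pi.single k 1)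
    rw [← sub_eq_zero, ← map_sub] at hx
    have h := R.constantCoeff_of_d_eq_zero i _ hx k
    by_contra hne
    have h0 : f (i + 1) x k = 0 := by
      rw [linearMap_apply_eq_sum]
      refine Finset.sum_eq_zero fun j _ => ?_
      obtain ⟨k', c, hc, hj⟩ := hf.map_basis (i + 1) j
      have : k ≠ k' := fun h => hne ⟨j, c, hc, h ▸ hj⟩
      rw [hj, Pi.single_eq_of_ne this, mul_zero]
    simp [h0] at h

/-- If the degrees of two basis elements differ by the degree of a nontrivial monomial, then no
minimal graded free resolution is strongly indispensable. -/
theorem not_stronglyIndispensable_of_deg (R : MinimalGradedResolution K n)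
    [Subsingleton (Fin (R.rank 0))] (i : ℕ) {j k : Fin (R.rank (i + 1))} (hjk : j ≠ k)
    {u : Fin 4 →₀ ℕ} (hu : u ≠ 0)
    (hdeg : R.deg (i + 1) j = Finsupp.weight n u + R.deg (i + 1) k)
    (F : MinimalGradedResolution K n) : ¬ F.StronglyIndispensable := by
  classical
  intro hF
  let τ : ∀ m, (Fin (R.rank m) → MvPolynomial (Fin 4) K) ≃ₗ[MvPolynomial (Fin 4) K]
      (Fin (R.rank m) → MvPolynomial (Fin 4) K) := fun m =>
    if h : m = i + 1 then
      h ▸ (transvectionEquiv u hjk : (Fin (R.rank (i + 1)) → MvPolynomial (Fin 4) K) ≃ₗ[_] _)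
    else LinearEquiv.refl _ _
  have hτi : τ (i + 1) = transvectionEquiv u hjk := dif_pos rfl
  have hτm : ∀ m, m ≠ i + 1 → τ m = LinearEquiv.refl _ _ := fun m hm => dif_neg hm
  obtain ⟨f, hfc, hfi, hfb⟩ := hF R
  have hτ : ∀ m l, IsHomogeneousVec n (R.deg m) (τ m (Pi.single l 1)) (R.deg m l) := fun m l => by
    by_cases h : m = i + 1
    · subst h; rw [hτi]; exact isHomogeneousVec_transvectionEquiv hjk hdeg l
    · rw [hτm m h]; exact isHomogeneousVec_single_one _ l
  have hτ' : ∀ m l, IsHomogeneousVec n (R.deg m) ((τ m).symm (Pi.single l 1)) (R.deg m l) :=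
    fun m l => by
      by_cases h : m = i + 1
      · subst h; rw [hτi]; exact isHomogeneousVec_transvectionEquiv_symm hjk hdeg l
      · rw [hτm m h]; exact isHomogeneousVec_single_one _ l
  -- Indispensability is used for R and again for R in the transvected basis. In the original basis
  -- the second embedding is τ ∘ f', to be compared with f.
  obtain ⟨f', hg, hfb'⟩ : ∃ f' : ∀ m, (Fin (F.rank m) → MvPolynomial (Fin 4) K)
      →ₗ[MvPolynomial (Fin 4) K] (Fin (R.rank m) → MvPolynomial (Fin 4) K),
      (∀ m v, R.d m (τ (m + 1) (f' (m + 1) v)) = τ m (f' m (F.d m v))) ∧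
      ∀ m l, ∃ k : Fin (R.rank m), ∃ c : K, c ≠ 0 ∧
        f' m (Pi.single l 1) = Pi.single k (C c) := by
    obtain ⟨f', hfc', -, hfb'⟩ := hF (R.changeBasis τ hτ hτ')
    refine ⟨f', fun m v => ?_, fun m l => ?_⟩
    · refine Eq.trans ?_ (congrArg (τ m) (LinearMap.congr_fun (hfc' m) v)).symm
      exact ((τ m).apply_symm_apply _).symm
    · obtain ⟨k, c, hc, -, h⟩ := hfb' m l
      exact ⟨k, c, hc, h⟩
  clear_value τ
  have hf : IsEmbedding F R f := ⟨hfc, hfi, fun m l => by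
    obtain ⟨k, c, hc, -, h⟩ := hfb m l
    exact ⟨k, c, hc, h⟩⟩
  have hker : ∀ m (c : K), (∀ v, τ m (f' m v) = (C c : MvPolynomial (Fin 4) K) • f m v) → ∀ v,
      R.d m (τ (m + 1) (f' (m + 1) v) - (C c : MvPolynomial (Fin 4) K) • f (m + 1) v) = 0 := by
    intro m c h v
    rw [map_sub, hg, h, map_smul, ← LinearMap.comp_apply, hfc, LinearMap.comp_apply, sub_self]
  have hext : ∀ m (c : K), (∀ l, τ m (f' m (Pi.single l 1)) =
      (C c : MvPolynomial (Fin 4) K) • f m (Pi.single l 1)) →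
      ∀ v, τ m (f' m v) = (C c : MvPolynomial (Fin 4) K) • f m v := by
    intro m c h v
    have : (τ m).toLinearMap ∘ₗ f' m = (C c : MvPolynomial (Fin 4) K) • f m :=
      LinearMap.pi_ext' fun l => LinearMap.ext_ring (h l)
    exact LinearMap.congr_fun this v
  -- Below the altered position the two embeddings agree up to one global scalar, fixed in rank one.
  -- If they agree at m, their difference at m + 1 is a cycle without constant terms, which forces
  -- equal multiples of the same basis element.
  have hscal : ∀ m, m < i + 1 → ∃ c : K, c ≠ 0 ∧
      ∀ v, τ m (f' m v) = (C c : MvPolynomial (Fin 4) K) • f m v := by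
    intro m
    induction m with
    | zero =>
      intro h0
      obtain ⟨l⟩ := F.nonempty_fin_rank_zero
      obtain ⟨k, a, ha, h⟩ := hf.map_basis 0 l
      obtain ⟨k', b, hb, h'⟩ := hfb' 0 l
      obtain rfl : k = k' := Subsingleton.elim (α := Fin (R.rank 0)) k k'
      refine ⟨b * a⁻¹, mul_ne_zero hb (inv_ne_zero ha), hext 0 _ fun l' => ?_⟩
      have := hf.subsingleton_zero
      obtain rfl := Subsingleton.elim l l'
      rw [h, h', hτm 0 h0.ne, ← Pi.single_smul, smul_eq_mul, ← C_mul, mul_assoc,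
        inv_mul_cancel₀ ha, mul_one]
      rfl
    | succ m ih =>
      intro hm
      obtain ⟨c, hc, h⟩ := ih (by omega)
      refine ⟨c, hc, hext _ _ fun l => ?_⟩
      have h0 := R.constantCoeff_of_d_eq_zero m _ (hker m c h (Pi.single l 1))
      obtain ⟨k, a, ha, h1⟩ := hf.map_basis (m + 1) l
      obtain ⟨k', b, hb, h2⟩ := hfb' (m + 1) l
      rw [hτm _ hm.ne, LinearEquiv.refl_apply, h1, h2, ← Pi.single_smul, smul_eq_mul,
        ← C_mul] at h0 ⊢
      have h3 := h0 k
      by_cases hk : k = k'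
      · subst hk
        simp only [Pi.sub_apply, Pi.single_eq_same, map_sub, constantCoeff_C, sub_eq_zero] at h3
        rw [h3]
      · simp [hk, ha, hc] at h3
  obtain ⟨c, hc, h⟩ := hscal i (Nat.lt_succ_self i)
  obtain ⟨l, a, ha, h1⟩ := hf.exists_basis (i + 1) j
  obtain ⟨k', b, hb, h2⟩ := hfb' (i + 1) l
  have hd := hker i c h (Pi.single l 1)
  have h0 := R.constantCoeff_of_d_eq_zero i _ hd
  rw [hτi, h1, h2] at h0 hd
  have hval : ∀ v : Fin (R.rank (i + 1)) → MvPolynomial (Fin 4) K,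
      transvectionEquiv u hjk v = v + Pi.single k (v j * monomial u 1) := fun _ => rfl
  rw [hval, ← Pi.single_smul, smul_eq_mul, ← C_mul] at h0 hd
  have hmon : constantCoeff (monomial u (1 : K)) = 0 := by
    rw [constantCoeff_monomial, if_neg hu]
  -- If k' = j, the difference is a nonzero multiple of X^u times the k-th basis element; cancelling
  -- X^u makes that basis element a cycle, against minimality. Otherwise the constant -c * a remains
  -- at j.
  by_cases hk : k' = j
  · subst hk
    have hb' : b = c * a := by
      have := h0 k'
      simpa [Pi.single_eq_of_ne hjk, sub_eq_zero] using this
    subst hb'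
    rw [Pi.single_eq_same, add_sub_cancel_left] at hd
    have : (C (c * a) * monomial u 1 : MvPolynomial (Fin 4) K) • R.d i (Pi.single k 1) = 0 := by
      rw [← map_smul, ← Pi.single_smul, smul_eq_mul, mul_one]
      exact hd
    rcases smul_eq_zero.1 this with h3 | h3
    · simp [ha, hc] at h3
    · have := R.constantCoeff_of_d_eq_zero i _ h3 k
      simp at this
  · have := h0 j
    simp [Pi.single_eq_of_ne (Ne.symm hk), ha, hc] at this

end MinimalGradedResolution

end ChangeOfBasis

/-! ### The defining ideal -/

/-- The arithmetic of the generators of a 4-generated pseudo-symmetric semigroup, in terms of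
`p = α₂₁`, `q = α₁ - α₂₁ - 1`, `a = α₂ - 1`, `b = α₃ - 1` and `c = α₄ - 1`. -/
structure KomedaRelations (n : Fin 4 → ℕ) (p q a b c : ℕ) : Prop where
  n_pos : ∀ i, 0 < n i
  gcd_eq_one : Finset.univ.gcd n = 1
  p_pos : 0 < p
  q_pos : 0 < q
  a_pos : 0 < a
  b_pos : 0 < b
  c_pos : 0 < c
  n_zero : n 0 = (a + 1) * (b + 1) * c + 1
  rel₁ : (p + q + 1) * n 0 = n 2 + c * n 3
  rel₂ : (a + 1) * n 1 = p * n 0 + n 3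
  rel₃ : (b + 1) * n 2 = q * n 0 + n 1
  rel₄ : (c + 1) * n 3 = n 0 + a * n 1 + b * n 2
  rel₅ : (p + 1) * n 0 + b * n 2 = n 1 + c * n 3

section Ideal

variable (K : Type*) [Field K] (p q a b c : ℕ)

/-- The five binomials generating the defining ideal of the semigroup ring. -/
def komedaBinomial : Fin 5 → MvPolynomial (Fin 4) K :=
  ![X 0 ^ (p + q + 1) - X 2 * X 3 ^ c,
    X 1 ^ (a + 1) - X 0 ^ p * X 3,
    X 2 ^ (b + 1) - X 0 ^ q * X 1,
    X 3 ^ (c + 1) - X 0 * X 1 ^ a * X 2 ^ b,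
    X 0 ^ (p + 1) * X 2 ^ b - X 1 * X 3 ^ c]

/-- The ideal generated by the five binomials. -/
def komedaIdeal : Ideal (MvPolynomial (Fin 4) K) :=
  Ideal.span (Set.range (komedaBinomial K p q a b c))

variable {K p q a b c}

theorem komedaBinomial_mem (i : Fin 5) :
    komedaBinomial K p q a b c i ∈ komedaIdeal K p q a b c :=
  Ideal.subset_span ⟨i, rfl⟩

/-- The exponents of monomials that are not divisible by a leading term of the five binomials. -/
def IsStandardExponent (a b c e₁ e₂ e₃ : ℕ) : Prop :=
  e₁ < a + 1 ∧ e₂ < b + 1 ∧ (e₃ < c ∨ e₁ = 0 ∧ e₂ = 0 ∧ e₃ = c)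

variable {n : Fin 4 → ℕ}

/-- Each binomial has one term divisible by X 0. Rewriting the other term (X 1 ^ (a + 1), X 2 ^ (b +
1), X 3 ^ (c + 1), X 2 * X 3 ^ c or X 1 * X 3 ^ c) into it raises e₀ at fixed degree. Since n 0 > 0
this terminates, with degree minus e₀ as measure. -/
theorem exists_standard_exponent (h : KomedaRelations n p q a b c) (e₀ e₁ e₂ e₃ : ℕ) :
    ∃ e₀' e₁' e₂' e₃', IsStandardExponent a b c e₁' e₂' e₃' ∧
      e₀' * n 0 + e₁' * n 1 + e₂' * n 2 + e₃' * n 3 =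
        e₀ * n 0 + e₁ * n 1 + e₂ * n 2 + e₃ * n 3 ∧
      (X 0 ^ e₀ * X 1 ^ e₁ * X 2 ^ e₂ * X 3 ^ e₃ -
        X 0 ^ e₀' * X 1 ^ e₁' * X 2 ^ e₂' * X 3 ^ e₃' : MvPolynomial (Fin 4) K) ∈
          komedaIdeal K p q a b c := by
  obtain ⟨d, hd⟩ : ∃ d, e₀ * n 0 + e₁ * n 1 + e₂ * n 2 + e₃ * n 3 - e₀ = d := ⟨_, rfl⟩
  induction d using Nat.strong_induction_on generalizing e₀ e₁ e₂ e₃ with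
  | _ d ih =>
  have step : ∀ f₀ f₁ f₂ f₃, e₀ < f₀ →
      f₀ * n 0 + f₁ * n 1 + f₂ * n 2 + f₃ * n 3 =
        e₀ * n 0 + e₁ * n 1 + e₂ * n 2 + e₃ * n 3 →
      (X 0 ^ e₀ * X 1 ^ e₁ * X 2 ^ e₂ * X 3 ^ e₃ -
        X 0 ^ f₀ * X 1 ^ f₁ * X 2 ^ f₂ * X 3 ^ f₃ : MvPolynomial (Fin 4) K) ∈
          komedaIdeal K p q a b c →
      ∃ e₀' e₁' e₂' e₃', IsStandardExponent a b c e₁' e₂' e₃' ∧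
      e₀' * n 0 + e₁' * n 1 + e₂' * n 2 + e₃' * n 3 =
        e₀ * n 0 + e₁ * n 1 + e₂ * n 2 + e₃ * n 3 ∧
      (X 0 ^ e₀ * X 1 ^ e₁ * X 2 ^ e₂ * X 3 ^ e₃ -
        X 0 ^ e₀' * X 1 ^ e₁' * X 2 ^ e₂' * X 3 ^ e₃' : MvPolynomial (Fin 4) K) ∈
          komedaIdeal K p q a b c := by
    intro f₀ f₁ f₂ f₃ hlt hw hmem
    have hle : f₀ ≤ f₀ * n 0 := Nat.le_mul_of_pos_right _ (h.n_pos 0)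
    obtain ⟨g₀, g₁, g₂, g₃, hs, hg, hI⟩ := ih _ (by omega) f₀ f₁ f₂ f₃ rfl
    refine ⟨g₀, g₁, g₂, g₃, hs, hg.trans hw, ?_⟩
    have := Ideal.add_mem _ hmem hI
    rwa [sub_add_sub_cancel] at this
  have hp := h.p_pos
  have hq := h.q_pos
  by_cases h1 : a + 1 ≤ e₁
  · obtain ⟨r, rfl⟩ := Nat.exists_eq_add_of_le h1
    refine step (e₀ + p) r e₂ (e₃ + 1) (by omega) (by linear_combination h.rel₂.symm) ?_
    have := Ideal.mul_mem_left _ (X 0 ^ e₀ * X 1 ^ r * X 2 ^ e₂ * X 3 ^ e₃ : MvPolynomial (Fin 4) K)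
      (komedaBinomial_mem (p := p) (q := q) (a := a) (b := b) (c := c) (1 : Fin 5))
    convert this using 1
    simp [komedaBinomial]
    ring
  by_cases h2 : b + 1 ≤ e₂
  · obtain ⟨r, rfl⟩ := Nat.exists_eq_add_of_le h2
    refine step (e₀ + q) (e₁ + 1) r e₃ (by omega) (by linear_combination h.rel₃.symm) ?_
    have := Ideal.mul_mem_left _ (X 0 ^ e₀ * X 1 ^ e₁ * X 2 ^ r * X 3 ^ e₃ : MvPolynomial (Fin 4) K)
      (komedaBinomial_mem (p := p) (q := q) (a := a) (b := b) (c := c) (2 : Fin 5))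
    convert this using 1
    simp [komedaBinomial]
    ring
  by_cases h3 : c + 1 ≤ e₃
  · obtain ⟨r, rfl⟩ := Nat.exists_eq_add_of_le h3
    refine step (e₀ + 1) (e₁ + a) (e₂ + b) r (by omega)
      (by linear_combination h.rel₄.symm) ?_
    have := Ideal.mul_mem_left _ (X 0 ^ e₀ * X 1 ^ e₁ * X 2 ^ e₂ * X 3 ^ r : MvPolynomial (Fin 4) K)
      (komedaBinomial_mem (p := p) (q := q) (a := a) (b := b) (c := c) (3 : Fin 5))
    convert this using 1
    simp [komedaBinomial]
    ring
  by_cases h4 : c ≤ e₃ ∧ 1 ≤ e₂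
  · obtain ⟨r, rfl⟩ := Nat.exists_eq_add_of_le h4.1
    obtain ⟨s, rfl⟩ := Nat.exists_eq_add_of_le h4.2
    refine step (e₀ + (p + q + 1)) e₁ s r (by omega)
      (by linear_combination h.rel₁) ?_
    have := Ideal.mul_mem_left _
      (-(X 0 ^ e₀ * X 1 ^ e₁ * X 2 ^ s * X 3 ^ r) : MvPolynomial (Fin 4) K)
      (komedaBinomial_mem (p := p) (q := q) (a := a) (b := b) (c := c) (0 : Fin 5))
    convert this using 1
    simp [komedaBinomial]
    ring
  by_cases h5 : c ≤ e₃ ∧ 1 ≤ e₁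
  · obtain ⟨r, rfl⟩ := Nat.exists_eq_add_of_le h5.1
    obtain ⟨s, rfl⟩ := Nat.exists_eq_add_of_le h5.2
    refine step (e₀ + (p + 1)) s (e₂ + b) r (by omega)
      (by linear_combination h.rel₅) ?_
    have := Ideal.mul_mem_left _
      (-(X 0 ^ e₀ * X 1 ^ s * X 2 ^ e₂ * X 3 ^ r) : MvPolynomial (Fin 4) K)
      (komedaBinomial_mem (p := p) (q := q) (a := a) (b := b) (c := c) (4 : Fin 5))
    convert this using 1
    simp [komedaBinomial]
    ring
  · exact ⟨e₀, e₁, e₂, e₃, by unfold IsStandardExponent; omega, rfl, by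
      rw [sub_self]; exact zero_mem _⟩

theorem exists_weight_eq_mod (hgcd : Finset.univ.gcd n = 1) [NeZero (n 0)] (z : ZMod (n 0)) :
    ∃ e₀ e₁ e₂ e₃ : ℕ, ((e₀ * n 0 + e₁ * n 1 + e₂ * n 2 + e₃ * n 3 : ℕ) : ZMod (n 0)) = z := by
  obtain ⟨f, hf⟩ := Finset.gcd_eq_sum_mul Finset.univ fun i => (n i : ℤ)
  set g : ℤ := Finset.univ.gcd fun i => (n i : ℤ) with hg
  have hunit : g.natAbs = 1 := by
    rw [← Nat.dvd_one, ← hgcd]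
    exact Finset.dvd_gcd fun i hi => Int.natAbs_dvd_natAbs.2 (Finset.gcd_dvd hi)
  have hgg : g * g = 1 := by
    rw [← Int.natAbs_mul_self, hunit]; rfl
  have hsum : ((∑ i, (n i : ℤ) * (g * f i) : ℤ) : ZMod (n 0)) = 1 := by
    have : ∑ i, (n i : ℤ) * (g * f i) = 1 := by
      calc ∑ i, (n i : ℤ) * (g * f i) = g * ∑ i, (n i : ℤ) * f i := by
            rw [Finset.mul_sum]
            exact Finset.sum_congr rfl fun i _ => by ring
        _ = 1 := by rw [← hf, hgg]
    rw [this, Int.cast_one]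
  -- Bézout coefficients may be negative; only their residues matter, so natural representatives
  -- serve.
  refine ⟨(z * ((g * f 0 : ℤ) : ZMod (n 0))).val, (z * ((g * f 1 : ℤ) : ZMod (n 0))).val,
    (z * ((g * f 2 : ℤ) : ZMod (n 0))).val, (z * ((g * f 3 : ℤ) : ZMod (n 0))).val, ?_⟩
  rw [Fin.sum_univ_four] at hsum
  push_cast at hsum ⊢
  simp only [ZMod.natCast_val, ZMod.cast_id', id_eq]
  linear_combination z * hsum

/-- The standard exponents are determined by the degree modulo `n 0`. -/
theorem standard_exponent_injective (h : KomedaRelations n p q a b c) {e₁ e₂ e₃ f₁ f₂ f₃ : ℕ}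
    (he : IsStandardExponent a b c e₁ e₂ e₃) (hf : IsStandardExponent a b c f₁ f₂ f₃)
    (hmod : ((e₁ * n 1 + e₂ * n 2 + e₃ * n 3 : ℕ) : ZMod (n 0)) =
      ((f₁ * n 1 + f₂ * n 2 + f₃ * n 3 : ℕ) : ZMod (n 0))) :
    e₁ = f₁ ∧ e₂ = f₂ ∧ e₃ = f₃ := by
  have : NeZero (n 0) := ⟨(h.n_pos 0).ne'⟩
  -- T has at most (a + 1)(b + 1)c + 1 = n 0 elements. Its degrees reach every residue modulo n 0,
  -- so they do so injectively.
  let T : Finset (ℕ × ℕ × ℕ) :=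
    insert (0, 0, c) (Finset.range (a + 1) ×ˢ Finset.range (b + 1) ×ˢ Finset.range c)
  have hT : ∀ x₁ x₂ x₃, IsStandardExponent a b c x₁ x₂ x₃ → (x₁, x₂, x₃) ∈ T := by
    intro x₁ x₂ x₃ hx
    simp only [T, Finset.mem_insert, Finset.mem_product, Finset.mem_range, Prod.mk.injEq]
    unfold IsStandardExponent at hx
    omega
  have hcard : T.card ≤ (Finset.univ : Finset (ZMod (n 0))).card := by
    refine (Finset.card_insert_le _ _).trans ?_
    simp only [Finset.card_product, Finset.card_range, Finset.card_univ, ZMod.card]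
    rw [h.n_zero, mul_assoc]
  have hinj := Finset.injOn_of_surjOn_of_card_le (s := T) (t := Finset.univ)
    (fun x => ((x.1 * n 1 + x.2.1 * n 2 + x.2.2 * n 3 : ℕ) : ZMod (n 0)))
    (fun _ _ => Finset.mem_coe.2 (Finset.mem_univ _))
    (fun z _ => by
      obtain ⟨x₀, x₁, x₂, x₃, hx⟩ := exists_weight_eq_mod h.gcd_eq_one z
      -- Only the numerical part is used, so any field will do.
      obtain ⟨y₀, y₁, y₂, y₃, hy, hw, -⟩ := exists_standard_exponent (K := ℚ) h x₀ x₁ x₂ x₃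
      refine ⟨(y₁, y₂, y₃), Finset.mem_coe.2 (hT _ _ _ hy), ?_⟩
      rw [← hw] at hx
      rw [← hx]
      push_cast
      simp) hcard
  have := hinj (Finset.mem_coe.2 (hT _ _ _ he)) (Finset.mem_coe.2 (hT _ _ _ hf)) hmod
  simpa using this

theorem monomial_one_eq_prod (u : Fin 4 →₀ ℕ) :
    (monomial u 1 : MvPolynomial (Fin 4) K) =
      X 0 ^ u 0 * X 1 ^ u 1 * X 2 ^ u 2 * X 3 ^ u 3 := by
  rw [monomial_eq, C_1, one_mul, Finsupp.prod_fintype _ _ (by simp), Fin.prod_univ_four]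

theorem weight_eq_sum_four (u : Fin 4 →₀ ℕ) :
    Finsupp.weight n u = u 0 * n 0 + u 1 * n 1 + u 2 * n 2 + u 3 * n 3 := by
  rw [Finsupp.weight_apply, Finsupp.sum_fintype _ _ (by simp), Fin.sum_univ_four]
  simp

/-- Both monomials reduce to a power of X 0 times a standard one. Equal degrees give equal residues,
hence the same standard monomial and then the same power of X 0. -/
theorem monomial_sub_mem_komedaIdeal (h : KomedaRelations n p q a b c) {u v : Fin 4 →₀ ℕ}
    (huv : Finsupp.weight n u = Finsupp.weight n v) :
    (monomial u 1 - monomial v 1 : MvPolynomial (Fin 4) K) ∈ komedaIdeal K p q a b c := by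
  rw [weight_eq_sum_four, weight_eq_sum_four] at huv
  rw [monomial_one_eq_prod, monomial_one_eq_prod]
  obtain ⟨e₀, e₁, e₂, e₃, he, hew, heI⟩ :=
    exists_standard_exponent (K := K) h (u 0) (u 1) (u 2) (u 3)
  obtain ⟨f₀, f₁, f₂, f₃, hf, hfw, hfI⟩ :=
    exists_standard_exponent (K := K) h (v 0) (v 1) (v 2) (v 3)
  have heq := (hew.trans huv).trans hfw.symm
  obtain ⟨rfl, rfl, rfl⟩ := standard_exponent_injective h he hf (by
    have := congrArg (Nat.cast : ℕ → ZMod (n 0)) heq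
    push_cast at this ⊢
    simpa using this)
  obtain rfl : e₀ = f₀ := Nat.eq_of_mul_eq_mul_right (h.n_pos 0) (by omega)
  have := Ideal.sub_mem _ heI hfI
  rwa [sub_sub_sub_cancel_right] at this

theorem mem_komedaIdeal_of_toricMap_eq_zero (h : KomedaRelations n p q a b c)
    {x : MvPolynomial (Fin 4) K} (hx : toricMap K n x = 0) : x ∈ komedaIdeal K p q a b c := by
  classical
  let ν : ℕ → Fin 4 →₀ ℕ := fun s =>
    if h : ∃ u, Finsupp.weight n u = s then h.choose else 0
  have hν : ∀ u : Fin 4 →₀ ℕ, Finsupp.weight n (ν (Finsupp.weight n u)) = Finsupp.weight n u := by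
    intro u
    have hu : ∃ v, Finsupp.weight n v = Finsupp.weight n u := ⟨u, rfl⟩
    simp only [ν, dif_pos hu]
    exact hu.choose_spec
  -- L replaces t ^ s by one chosen monomial of degree s, if there is one. Then x - L (toricMap x)
  -- is a combination of differences of monomials of equal degree.
  let L : Polynomial K →ₗ[K] MvPolynomial (Fin 4) K :=
    (Polynomial.basisMonomials K).constr K fun s => monomial (ν s) 1
  have hL : ∀ (s : ℕ) (r : K), L (Polynomial.monomial s r) = r • monomial (ν s) 1 := fun s r => by
    rw [← mul_one r, ← smul_eq_mul, ← Polynomial.smul_monomial, map_smul, smul_eq_mul, mul_one]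
    congr 1
    exact (Polynomial.basisMonomials K).constr_basis K _ s
  have key : x - L (toricMap K n x) ∈ komedaIdeal K p q a b c := by
    have hsum : x - L (toricMap K n x) = ∑ u ∈ x.support,
        (monomial u (coeff u x) - L (toricMap K n (monomial u (coeff u x)))) := by
      rw [Finset.sum_sub_distrib, ← map_sum, ← map_sum, ← x.as_sum]
    rw [hsum]
    refine Ideal.sum_mem _ fun u _ => ?_
    rw [toricMap_monomial, hL, ← mul_one (coeff u x), ← smul_eq_mul, ← smul_monomial, smul_eq_mul,
      mul_one, ← smul_sub, smul_eq_C_mul]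
    exact Ideal.mul_mem_left _ _ (monomial_sub_mem_komedaIdeal h (hν u).symm)
  rwa [hx, map_zero, sub_zero] at key

theorem toricMap_komedaBinomial (h : KomedaRelations n p q a b c) (i : Fin 5) :
    toricMap K n (komedaBinomial K p q a b c i) = 0 := by
  have h₁ := h.rel₁
  have h₂ := h.rel₂
  have h₃ := h.rel₃
  have h₄ := h.rel₄
  have h₅ := h.rel₅
  have hX : ∀ i, toricMap K n (X i) = Polynomial.X ^ n i := fun i => by simp [toricMap]
  fin_cases i <;>
    simp only [komedaBinomial, Fin.zero_eta, Fin.mk_one, Fin.reduceFinMk, Matrix.cons_val,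
      map_sub, map_mul, map_pow, hX, ← pow_mul, ← pow_add, sub_eq_zero] <;>
    congr 1 <;> linarith

/-- The exponents of monomials divisible by no term of the five binomials. -/
def IsIndispensableExponent (p q a b c m₀ m₁ m₂ m₃ : ℕ) : Prop :=
  m₀ < p + q + 1 ∧ (m₂ < 1 ∨ m₃ < c) ∧ m₁ < a + 1 ∧ (m₀ < p ∨ m₃ < 1) ∧ m₂ < b + 1 ∧
    (m₀ < q ∨ m₁ < 1) ∧ m₃ < c + 1 ∧ (m₀ < 1 ∨ m₁ < a ∨ m₂ < b) ∧ (m₀ < p + 1 ∨ m₂ < b) ∧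
    (m₁ < 1 ∨ m₃ < c)

/-- The exponent vector with the given entries. -/
def exponent (e₀ e₁ e₂ e₃ : ℕ) : Fin 4 →₀ ℕ := Finsupp.equivFunOnFinite.symm ![e₀, e₁, e₂, e₃]

theorem monomial_exponent (e₀ e₁ e₂ e₃ : ℕ) :
    (monomial (exponent e₀ e₁ e₂ e₃) 1 : MvPolynomial (Fin 4) K) =
      X 0 ^ e₀ * X 1 ^ e₁ * X 2 ^ e₂ * X 3 ^ e₃ := by
  rw [monomial_one_eq_prod]; rfl

theorem weight_exponent (e₀ e₁ e₂ e₃ : ℕ) :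
    Finsupp.weight n (exponent e₀ e₁ e₂ e₃) = e₀ * n 0 + e₁ * n 1 + e₂ * n 2 + e₃ * n 3 := by
  rw [weight_eq_sum_four]; rfl

theorem exponent_le_iff {e₀ e₁ e₂ e₃ : ℕ} {u : Fin 4 →₀ ℕ} :
    exponent e₀ e₁ e₂ e₃ ≤ u ↔ e₀ ≤ u 0 ∧ e₁ ≤ u 1 ∧ e₂ ≤ u 2 ∧ e₃ ≤ u 3 := by
  rw [Finsupp.le_def, Fin.forall_fin_succ, Fin.forall_fin_succ, Fin.forall_fin_succ,
    Fin.forall_fin_one]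
  rfl

/-- A monomial divisible by no term of the five binomials is alone in its degree. -/
theorem eq_of_weight_eq_weight (h : KomedaRelations n p q a b c) {u v : Fin 4 →₀ ℕ}
    (hu : IsIndispensableExponent p q a b c (u 0) (u 1) (u 2) (u 3))
    (huv : Finsupp.weight n u = Finsupp.weight n v) : u = v := by
  classical
  let s : Set (Fin 4 →₀ ℕ) :=
    {exponent (p + q + 1) 0 0 0, exponent 0 0 1 c, exponent 0 (a + 1) 0 0, exponent p 0 0 1,
      exponent 0 0 (b + 1) 0, exponent q 1 0 0, exponent 0 0 0 (c + 1), exponent 1 a b 0,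
      exponent (p + 1) 0 b 0, exponent 0 1 0 c}
  -- The binomial ideal lies in the monomial ideal of its ten terms. If u ≠ v, then u occurs in the
  -- difference of the two monomials, so one of the terms divides it.
  have hle : komedaIdeal ℚ p q a b c ≤ Ideal.span ((fun e => monomial e 1) '' s) := by
    have hmem : ∀ e ∈ s, (monomial e 1 : MvPolynomial (Fin 4) ℚ) ∈
        Ideal.span ((fun e => monomial e (1 : ℚ)) '' s) := fun e he =>
      Ideal.subset_span ⟨e, he, rfl⟩
    refine Ideal.span_le.2 ?_
    rintro _ ⟨i, rfl⟩
    fin_cases i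
    · convert Ideal.sub_mem _ (hmem (exponent (p + q + 1) 0 0 0) (by simp [s]))
        (hmem (exponent 0 0 1 c) (by simp [s])) using 1
      simp [komedaBinomial, monomial_exponent]
    · convert Ideal.sub_mem _ (hmem (exponent 0 (a + 1) 0 0) (by simp [s]))
        (hmem (exponent p 0 0 1) (by simp [s])) using 1
      simp [komedaBinomial, monomial_exponent]
    · convert Ideal.sub_mem _ (hmem (exponent 0 0 (b + 1) 0) (by simp [s]))
        (hmem (exponent q 1 0 0) (by simp [s])) using 1
      simp [komedaBinomial, monomial_exponent]
    · convert Ideal.sub_mem _ (hmem (exponent 0 0 0 (c + 1)) (by simp [s]))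
        (hmem (exponent 1 a b 0) (by simp [s])) using 1
      simp [komedaBinomial, monomial_exponent]
    · convert Ideal.sub_mem _ (hmem (exponent (p + 1) 0 b 0) (by simp [s]))
        (hmem (exponent 0 1 0 c) (by simp [s])) using 1
      simp [komedaBinomial, monomial_exponent]
  by_contra hne
  obtain ⟨e, he, heu⟩ := mem_ideal_span_monomial_image.1
    (hle (monomial_sub_mem_komedaIdeal h huv)) u
    (by simp [mem_support_iff, coeff_monomial, Ne.symm hne])
  unfold IsIndispensableExponent at hu
  simp only [s, Set.mem_insert_iff, Set.mem_singleton_iff] at he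
  rcases he with rfl | rfl | rfl | rfl | rfl | rfl | rfl | rfl | rfl | rfl <;>
    rw [exponent_le_iff] at heu <;> omega

theorem weight_ne_weight_add (h : KomedaRelations n p q a b c) (m₀ m₁ m₂ m₃ k₀ k₁ k₂ k₃ : ℕ)
    (hm : IsIndispensableExponent p q a b c m₀ m₁ m₂ m₃)
    (hk : m₀ < k₀ ∨ m₁ < k₁ ∨ m₂ < k₂ ∨ m₃ < k₃) (u : Fin 4 →₀ ℕ) :
    m₀ * n 0 + m₁ * n 1 + m₂ * n 2 + m₃ * n 3 ≠
      Finsupp.weight n u + (k₀ * n 0 + k₁ * n 1 + k₂ * n 2 + k₃ * n 3) := by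
  rw [← weight_exponent, ← weight_exponent, ← map_add]
  intro hw
  have := eq_of_weight_eq_weight h (u := exponent m₀ m₁ m₂ m₃) hm hw
  have hle : exponent k₀ k₁ k₂ k₃ ≤ exponent m₀ m₁ m₂ m₃ := this ▸ le_add_self
  have := exponent_le_iff.1 hle
  simp only [exponent, Finsupp.equivFunOnFinite_symm_apply_apply, Matrix.cons_val] at this
  omega

end Ideal

/-! ### Reduction modulo the first variable -/

section Reduction

variable {K : Type*} [Field K]

/-- Setting the first variable to zero. -/
def killFirst (K : Type*) [Field K] : MvPolynomial (Fin 4) K →ₐ[K] MvPolynomial (Fin 3) K :=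
  aeval ![0, X 0, X 1, X 2]

@[simp] theorem killFirst_X_zero : killFirst K (X 0) = 0 := by simp [killFirst]

@[simp] theorem killFirst_X_one : killFirst K (X 1) = X 0 := by simp [killFirst]

@[simp] theorem killFirst_X_two : killFirst K (X 2) = X 1 := by simp [killFirst]

@[simp] theorem killFirst_X_three : killFirst K (X 3) = X 2 := by simp [killFirst]

theorem killFirst_rename (x : MvPolynomial (Fin 3) K) :
    killFirst K (rename Fin.succ x) = x := by
  rw [killFirst, aeval_rename]
  have : (![0, X 0, X 1, X 2] : Fin 4 → MvPolynomial (Fin 3) K) ∘ Fin.succ = X := by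
    funext i
    fin_cases i <;> rfl
  rw [this, aeval_X_left_apply]

theorem X_zero_dvd_of_killFirst_eq_zero {x : MvPolynomial (Fin 4) K} (hx : killFirst K x = 0) :
    X 0 ∣ x := by
  have key : ∀ y : MvPolynomial (Fin 4) K, X 0 ∣ y - rename Fin.succ (killFirst K y) := by
    intro y
    induction y using MvPolynomial.induction_on with
    | C r => simp [killFirst, algebraMap_eq]
    | add y z hy hz =>
      rw [map_add, map_add, add_sub_add_comm]
      exact dvd_add hy hz
    | mul_X y i hy =>
      have hi : X 0 ∣ X i - rename Fin.succ (killFirst K (X i)) := by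
        fin_cases i <;> simp
      obtain ⟨s, hs⟩ := hy
      obtain ⟨t, ht⟩ := hi
      refine ⟨s * X i + rename Fin.succ (killFirst K y) * t, ?_⟩
      rw [map_mul, map_mul]
      linear_combination X i * hs + rename Fin.succ (killFirst K y) * ht
  simpa [hx] using key x

theorem X_pow_dvd_of_dvd_mul_X_pow {σ : Type*} {i j : σ} (hij : i ≠ j) (k l : ℕ)
    {x : MvPolynomial σ K} (h : X i ^ k ∣ x * X j ^ l) : X i ^ k ∣ x := by
  refine X_prime.pow_dvd_of_dvd_mul_right k (fun hd => ?_) h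
  have := X_prime.dvd_of_dvd_pow hd
  rw [X_dvd_X] at this
  exact hij this

/-- Membership in a monomial ideal is read off the support, and the exponent of X 2 plays no role
for these generators. -/
theorem mem_span_of_mul_X_pow_mem {i j k : ℕ} {w : MvPolynomial (Fin 3) K}
    (h : w * X 2 ^ k ∈ Ideal.span {X 0 ^ i, X 1 ^ j}) :
    w ∈ Ideal.span {X 0 ^ i, (X 1 : MvPolynomial (Fin 3) K) ^ j} := by
  have hset : ({X 0 ^ i, X 1 ^ j} : Set (MvPolynomial (Fin 3) K)) =
      (fun s => monomial s (1 : K)) '' {Finsupp.single 0 i, Finsupp.single 1 j} := by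
    simp [Set.image_pair, X_pow_eq_monomial]
  rw [hset, mem_ideal_span_monomial_image] at h ⊢
  intro u hu
  obtain ⟨s, hs, hsu⟩ := h (u + Finsupp.single 2 k) (by
    rw [X_pow_eq_monomial, mem_support_iff, coeff_mul_monomial, mul_one]
    exact mem_support_iff.1 hu)
  refine ⟨s, hs, ?_⟩
  rcases hs with rfl | rfl <;> rw [Finsupp.single_le_iff] at hsu ⊢ <;> simpa using hsu

/-- Powers of the variables form a regular sequence: relations between them are Koszul. -/
theorem exists_koszul_relation {i j k : ℕ} {x y z : MvPolynomial (Fin 3) K}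
    (h : x * X 0 ^ i + y * X 1 ^ j + z * X 2 ^ k = 0) :
    ∃ r s t, x = r * X 1 ^ j + s * X 2 ^ k ∧ y = -r * X 0 ^ i + t * X 2 ^ k ∧
      z = -s * X 0 ^ i - t * X 1 ^ j := by
  obtain ⟨s, t, hst⟩ := Ideal.mem_span_pair.1 (mem_span_of_mul_X_pow_mem
    (Ideal.mem_span_pair.2 ⟨-x, -y, by linear_combination -h⟩ :
      z * X 2 ^ k ∈ Ideal.span {X 0 ^ i, X 1 ^ j}))
  obtain ⟨r, hr⟩ := X_pow_dvd_of_dvd_mul_X_pow (zero_ne_one : (0 : Fin 3) ≠ 1) i j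
    (x := y + t * X 2 ^ k) ⟨-(x + s * X 2 ^ k), by linear_combination h + X 2 ^ k * hst⟩
  refine ⟨-r, -s, -t, ?_, by linear_combination hr, by linear_combination -hst⟩
  have hX : (X 0 ^ i : MvPolynomial (Fin 3) K) ≠ 0 := pow_ne_zero _ (X_ne_zero _)
  refine mul_right_cancel₀ hX ?_
  linear_combination h + X 2 ^ k * hst - X 1 ^ j * hr

/-- First syzygies of `(x ^ (a + 1), y ^ (b + 1)) + z ^ c (x, y, z)`. -/
theorem exists_first_syzygy {a b c : ℕ} {v₁ v₂ v₃ v₄ v₅ : MvPolynomial (Fin 3) K}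
    (h : -(X 1 * X 2 ^ c) * v₁ + X 0 ^ (a + 1) * v₂ + X 1 ^ (b + 1) * v₃ + X 2 ^ (c + 1) * v₄ -
      X 0 * X 2 ^ c * v₅ = 0) :
    ∃ w₁ w₂ w₃ w₄ w₅ w₆ : MvPolynomial (Fin 3) K,
      v₁ = X 0 * w₁ + X 1 ^ b * w₃ + X 2 * w₅ ∧
      v₂ = X 1 ^ (b + 1) * w₂ + X 2 ^ c * w₆ ∧
      v₃ = -X 0 ^ (a + 1) * w₂ + X 2 ^ c * w₃ ∧
      v₄ = X 0 * w₄ + X 1 * w₅ ∧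
      v₅ = -X 1 * w₁ + X 2 * w₄ + X 0 ^ a * w₆ := by
  -- Grouping the terms with X 2 ^ c gives a relation among three powers. Its third component is
  -- again a relation, now among the variables themselves.
  obtain ⟨k₁, k₂, k₃, h1, h2, h3⟩ := exists_koszul_relation (i := a + 1) (j := b + 1) (k := c)
    (x := v₂) (y := v₃) (z := -X 1 * v₁ + X 2 * v₄ - X 0 * v₅) (by linear_combination h)
  obtain ⟨l₁, l₂, l₃, h4, h5, h6⟩ := exists_koszul_relation (i := 1) (j := 1) (k := 1)
    (x := -v₅ + k₂ * X 0 ^ a) (y := -v₁ + k₃ * X 1 ^ b) (z := v₄) (by linear_combination h3)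
  exact ⟨l₁, k₁, k₃, -l₂, -l₃, k₂, by linear_combination -h5, by linear_combination h1,
    by linear_combination h2, by linear_combination h6, by linear_combination -h4⟩

/-- Second syzygies of `(x ^ (a + 1), y ^ (b + 1)) + z ^ c (x, y, z)`. -/
theorem exists_second_syzygy {a b c : ℕ} {w₁ w₂ w₃ w₄ w₅ w₆ : MvPolynomial (Fin 3) K}
    (h1 : X 0 * w₁ + X 1 ^ b * w₃ + X 2 * w₅ = 0)
    (h2 : X 1 ^ (b + 1) * w₂ + X 2 ^ c * w₆ = 0)
    (h3 : -X 0 ^ (a + 1) * w₂ + X 2 ^ c * w₃ = 0)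
    (h4 : X 0 * w₄ + X 1 * w₅ = 0) :
    ∃ s t : MvPolynomial (Fin 3) K,
      w₁ = X 2 * s - X 0 ^ a * X 1 ^ b * t ∧ w₂ = X 2 ^ c * t ∧ w₃ = X 0 ^ (a + 1) * t ∧
      w₄ = X 1 * s ∧ w₅ = -X 0 * s ∧ w₆ = -X 1 ^ (b + 1) * t := by
  have hz : (X 2 ^ c : MvPolynomial (Fin 3) K) ≠ 0 := pow_ne_zero _ (X_ne_zero _)
  have hx : (X 0 : MvPolynomial (Fin 3) K) ≠ 0 := X_ne_zero _
  obtain ⟨t, ht⟩ := X_pow_dvd_of_dvd_mul_X_pow (by decide : (2 : Fin 3) ≠ 1) c (b + 1) (x := w₂)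
    ⟨-w₆, by linear_combination h2⟩
  have h6 : w₆ = -X 1 ^ (b + 1) * t := mul_left_cancel₀ hz (by
    linear_combination h2 - X 1 ^ (b + 1) * ht)
  have h3' : w₃ = X 0 ^ (a + 1) * t := mul_left_cancel₀ hz (by
    linear_combination h3 + X 0 ^ (a + 1) * ht)
  obtain ⟨s, hs⟩ := X_pow_dvd_of_dvd_mul_X_pow (by decide : (0 : Fin 3) ≠ 2) 1 1 (x := -w₅)
    ⟨w₁ + X 0 ^ a * X 1 ^ b * t, by linear_combination -h1 + X 1 ^ b * h3'⟩
  have h4' : w₄ = X 1 * s := mul_left_cancel₀ hx (by linear_combination h4 + X 1 * hs)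
  refine ⟨s, t, mul_left_cancel₀ hx ?_, ht, h3', h4', by linear_combination -hs, h6⟩
  linear_combination h1 + X 2 * hs - X 1 ^ b * h3'

end Reduction

/-! ### The resolution -/

section Resolution

variable (K : Type*) [Field K] (p q a b c : ℕ)

/-- The matrix of the first differential. -/
def komedaMatrix₀ : Matrix (Fin 1) (Fin 5) (MvPolynomial (Fin 4) K) :=
  !![X 0 ^ (p + q + 1) - X 2 * X 3 ^ c, X 1 ^ (a + 1) - X 0 ^ p * X 3,
    X 2 ^ (b + 1) - X 0 ^ q * X 1, X 3 ^ (c + 1) - X 0 * X 1 ^ a * X 2 ^ b,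
    X 0 ^ (p + 1) * X 2 ^ b - X 1 * X 3 ^ c]

/-- The matrix of the second differential. -/
def komedaMatrix₁ : Matrix (Fin 5) (Fin 6) (MvPolynomial (Fin 4) K) :=
  !![X 1, 0, X 2 ^ b, 0, X 3, 0;
    0, X 2 ^ (b + 1) - X 0 ^ q * X 1, 0, X 0 * X 2 ^ b, X 0 ^ (q + 1), X 3 ^ c;
    X 0 ^ (p + 1), X 0 ^ p * X 3 - X 1 ^ (a + 1), X 3 ^ c, 0, X 0 * X 1 ^ a, 0;
    0, 0, 0, X 1, X 2, X 0 ^ p;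
    -X 2, 0, -X 0 ^ q, X 3, 0, X 1 ^ a]

/-- The matrix of the third differential. -/
def komedaMatrix₂ : Matrix (Fin 6) (Fin 2) (MvPolynomial (Fin 4) K) :=
  !![X 3, -(X 1 ^ a * X 2 ^ b);
    -X 0, X 3 ^ c;
    0, X 1 ^ (a + 1) - X 0 ^ p * X 3;
    X 2, -X 0 ^ (p + q);
    -X 1, X 0 ^ p * X 2 ^ b;
    0, X 0 ^ q * X 1 - X 2 ^ (b + 1)]

variable {K p q a b c}

theorem komedaMatrix₀_mul_komedaMatrix₁ :
    komedaMatrix₀ K p q a b c * komedaMatrix₁ K p q a b c = 0 := by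
  ext1 i j
  fin_cases i
  fin_cases j <;>
    simp [komedaMatrix₀, komedaMatrix₁, Matrix.mul_apply, Fin.sum_univ_succ] <;> ring

theorem komedaMatrix₁_mul_komedaMatrix₂ :
    komedaMatrix₁ K p q a b c * komedaMatrix₂ K p q a b c = 0 := by
  ext1 i j
  fin_cases i <;> fin_cases j <;>
    simp [komedaMatrix₁, komedaMatrix₂, Matrix.mul_apply, Fin.sum_univ_succ] <;> ring

/-- As p, q > 0, setting X 0 = 0 kills every mixed term with X 0, and the five binomials become, up
to sign, the generators of (x ^ (a + 1), y ^ (b + 1)) + z ^ c (x, y, z). -/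
theorem komedaMatrix₀_mod (hp : p ≠ 0) (hq : q ≠ 0) (v : Fin 5 → MvPolynomial (Fin 4) K)
    (hv : (komedaMatrix₀ K p q a b c).mulVecLin v = 0) :
    ∃ w, ∀ k, X 0 ∣ (v - (komedaMatrix₁ K p q a b c).mulVecLin w) k := by
  have h := congrArg (killFirst K) (congrFun hv 0)
  simp [komedaMatrix₀, Matrix.mulVec, dotProduct, Fin.sum_univ_succ, hp, hq] at h
  obtain ⟨w₁, w₂, w₃, w₄, w₅, w₆, h1, h2, h3, h4, h5⟩ := exists_first_syzygy
    (a := a) (b := b) (c := c) (v₁ := killFirst K (v 0)) (v₂ := killFirst K (v 1))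
    (v₃ := killFirst K (v 2)) (v₄ := killFirst K (v 3)) (v₅ := killFirst K (v 4))
    (by linear_combination h)
  refine ⟨fun i => rename Fin.succ (![w₁, w₂, w₃, w₄, w₅, w₆] i), fun k =>
    X_zero_dvd_of_killFirst_eq_zero ?_⟩
  fin_cases k <;>
    simp [komedaMatrix₁, dotProduct, Fin.sum_univ_succ, hp, hq,
      killFirst_rename, h1, h2, h3, h4, h5] <;> ring

theorem komedaMatrix₁_mod (hp : p ≠ 0) (hq : q ≠ 0) (v : Fin 6 → MvPolynomial (Fin 4) K)
    (hv : (komedaMatrix₁ K p q a b c).mulVecLin v = 0) :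
    ∃ w, ∀ k, X 0 ∣ (v - (komedaMatrix₂ K p q a b c).mulVecLin w) k := by
  have h (k) := congrArg (killFirst K) (congrFun hv k)
  have e1 := h 0
  have e2 := h 1
  have e3 := h 2
  have e4 := h 3
  simp [komedaMatrix₁, Matrix.mulVec, dotProduct, Fin.sum_univ_succ, hp, hq] at e1 e2 e3 e4
  obtain ⟨s, t, h1, h2, h3, h4, h5, h6⟩ := exists_second_syzygy
    (a := a) (b := b) (c := c) (w₁ := killFirst K (v 0)) (w₂ := killFirst K (v 1))
    (w₃ := killFirst K (v 2)) (w₄ := killFirst K (v 3)) (w₅ := killFirst K (v 4))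
    (w₆ := killFirst K (v 5))
    (by linear_combination e1) (by linear_combination e2) (by linear_combination e3)
    (by linear_combination e4)
  refine ⟨fun i => rename Fin.succ (![s, t] i), fun k =>
    X_zero_dvd_of_killFirst_eq_zero ?_⟩
  fin_cases k <;>
    simp [komedaMatrix₂, dotProduct, Fin.sum_univ_succ, hp, hq,
      killFirst_rename, h1, h2, h3, h4, h5, h6] <;> ring

theorem komedaMatrix₂_injective (hp : p ≠ 0) (v : Fin 2 → MvPolynomial (Fin 4) K)
    (hv : (komedaMatrix₂ K p q a b c).mulVecLin v = 0) : v = 0 := by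
  have h0 := congrFun hv 0
  have h2 := congrFun hv 2
  simp [komedaMatrix₂, Matrix.mulVec, dotProduct, Fin.sum_univ_succ] at h0 h2
  have hne : (X 1 ^ (a + 1) - X 0 ^ p * X 3 : MvPolynomial (Fin 4) K) ≠ 0 := fun h => by
    have := congrArg (killFirst K) h
    simp [hp] at this
  have hv1 : v 1 = 0 := h2.resolve_left hne
  have hv0 : v 0 = 0 := by simpa [hv1] using h0
  funext k
  fin_cases k
  · exact hv0
  · exact hv1

end Resolution

/-! ### Degrees, homogeneity, exactness and minimality of the resolution -/

section Resolution

/-- The degrees of the generators of the defining ideal. -/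
def komedaDeg₁ (n : Fin 4 → ℕ) (p q a b c : ℕ) : Fin 5 → ℕ :=
  ![(p + q + 1) * n 0, (a + 1) * n 1, (b + 1) * n 2, (c + 1) * n 3, n 1 + c * n 3]

/-- The degrees of the first syzygies. -/
def komedaDeg₂ (n : Fin 4 → ℕ) (p q a b c : ℕ) : Fin 6 → ℕ :=
  ![(p + q + 1) * n 0 + n 1, (a + 1) * n 1 + (b + 1) * n 2, (p + q + 1) * n 0 + b * n 2,
    (c + 1) * n 3 + n 1, (p + q + 1) * n 0 + n 3, n 1 + c * n 3 + a * n 1]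

/-- The degrees of the second syzygies. -/
def komedaDeg₃ (n : Fin 4 → ℕ) (p q a b c : ℕ) : Fin 2 → ℕ :=
  ![(p + q + 1) * n 0 + n 1 + n 3, (a + 1) * n 1 + (b + 1) * n 2 + c * n 3]

variable {K : Type*} [Field K] {n : Fin 4 → ℕ} {p q a b c : ℕ}

/-- All terms of `x` have the degree that makes `x` an entry of a homogeneous matrix. -/
def IsHomogeneousEntry (n : Fin 4 → ℕ) (x : MvPolynomial (Fin 4) K) (d e : ℕ) : Prop :=
  ∀ u ∈ x.support, Finsupp.weight n u + d = e

theorem IsHomogeneousEntry.zero {d e : ℕ} :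
    IsHomogeneousEntry n (0 : MvPolynomial (Fin 4) K) d e := by
  intro u hu
  simp at hu

theorem IsHomogeneousEntry.neg {x : MvPolynomial (Fin 4) K} {d e : ℕ}
    (hx : IsHomogeneousEntry n x d e) : IsHomogeneousEntry n (-x) d e := by
  intro u hu
  rw [support_neg] at hu
  exact hx u hu

theorem IsHomogeneousEntry.sub {x y : MvPolynomial (Fin 4) K} {d e : ℕ}
    (hx : IsHomogeneousEntry n x d e) (hy : IsHomogeneousEntry n y d e) :
    IsHomogeneousEntry n (x - y) d e := by
  classical
  intro u hu
  rcases Finset.mem_union.1 (support_sub _ _ _ hu) with h | h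
  · exact hx u h
  · exact hy u h

theorem IsHomogeneousEntry.of_isWeightedHomogeneous {x : MvPolynomial (Fin 4) K} {d e m : ℕ}
    (hx : IsWeightedHomogeneous n x m) (hm : m + d = e) : IsHomogeneousEntry n x d e := by
  intro u hu
  rw [hx (mem_support_iff.1 hu), hm]

theorem mulVecLin_single {r s : ℕ} (M : Matrix (Fin r) (Fin s) (MvPolynomial (Fin 4) K))
    (j : Fin s) (k : Fin r) : M.mulVecLin (Pi.single j 1) k = M k j := by
  simp

theorem komedaMatrix₀_homogeneous (h : KomedaRelations n p q a b c) (j : Fin 5) (k : Fin 1) :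
    IsHomogeneousEntry n (komedaMatrix₀ K p q a b c k j)
      0 (komedaDeg₁ n p q a b c j) := by
  have h₁ := h.rel₁
  have h₂ := h.rel₂
  have h₃ := h.rel₃
  have h₄ := h.rel₄
  have h₅ := h.rel₅
  fin_cases k
  fin_cases j <;>
    simp only [komedaMatrix₀, komedaDeg₁, Fin.zero_eta, Fin.mk_one, Fin.reduceFinMk,
      Fin.isValue, Matrix.of_apply, Matrix.cons_val, Matrix.cons_val_zero] <;>
    refine IsHomogeneousEntry.sub ?_ ?_ <;>
    refine IsHomogeneousEntry.of_isWeightedHomogeneous (by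
      repeat' first
        | with_reducible exact isWeightedHomogeneous_X K n _
        | with_reducible apply IsWeightedHomogeneous.pow
        | with_reducible apply IsWeightedHomogeneous.mul)
      (by simp only [smul_eq_mul]; linarith)

theorem komedaMatrix₁_homogeneous (h : KomedaRelations n p q a b c) (j : Fin 6) (k : Fin 5) :
    IsHomogeneousEntry n (komedaMatrix₁ K p q a b c k j)
      (komedaDeg₁ n p q a b c k) (komedaDeg₂ n p q a b c j) := by
  have h₁ := h.rel₁
  have h₂ := h.rel₂
  have h₃ := h.rel₃
  have h₄ := h.rel₄
  have h₅ := h.rel₅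
  fin_cases k <;> fin_cases j <;>
    simp only [komedaMatrix₁, komedaDeg₁, komedaDeg₂, Fin.zero_eta, Fin.mk_one, Fin.reduceFinMk,
      Fin.isValue, Matrix.of_apply, Matrix.cons_val, Matrix.cons_val_zero] <;>
    (repeat' first
      | with_reducible exact IsHomogeneousEntry.zero
      | with_reducible apply IsHomogeneousEntry.neg
      | with_reducible apply IsHomogeneousEntry.sub) <;>
    refine IsHomogeneousEntry.of_isWeightedHomogeneous (by
      repeat' first
        | with_reducible exact isWeightedHomogeneous_X K n _
        | with_reducible apply IsWeightedHomogeneous.pow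
        | with_reducible apply IsWeightedHomogeneous.mul)
      (by (try simp only [smul_eq_mul]) <;> linarith)

theorem komedaMatrix₂_homogeneous (h : KomedaRelations n p q a b c) (j : Fin 2) (k : Fin 6) :
    IsHomogeneousEntry n (komedaMatrix₂ K p q a b c k j)
      (komedaDeg₂ n p q a b c k) (komedaDeg₃ n p q a b c j) := by
  have h₁ := h.rel₁
  have h₂ := h.rel₂
  have h₃ := h.rel₃
  have h₄ := h.rel₄
  have h₅ := h.rel₅
  fin_cases k <;> fin_cases j <;>
    simp only [komedaMatrix₂, komedaDeg₂, komedaDeg₃, Fin.zero_eta, Fin.mk_one, Fin.reduceFinMk,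
      Fin.isValue, Matrix.of_apply, Matrix.cons_val, Matrix.cons_val_zero] <;>
    (repeat' first
      | with_reducible exact IsHomogeneousEntry.zero
      | with_reducible apply IsHomogeneousEntry.neg
      | with_reducible apply IsHomogeneousEntry.sub) <;>
    refine IsHomogeneousEntry.of_isWeightedHomogeneous (by
      repeat' first
        | with_reducible exact isWeightedHomogeneous_X K n _
        | with_reducible apply IsWeightedHomogeneous.pow
        | with_reducible apply IsWeightedHomogeneous.mul)
      (by (try simp only [smul_eq_mul]); linarith)

variable (K n) in
/-- The natural surjection onto the semigroup ring. -/
def toricAug : (Fin 1 → MvPolynomial (Fin 4) K) →ₗ[MvPolynomial (Fin 4) K] semigroupRing K n where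
  toFun v := (toricMap K n).rangeRestrict (v 0)
  map_add' _ _ := map_add _ _ _
  map_smul' _ _ := map_mul _ _ _

theorem coe_toricAug (v : Fin 1 → MvPolynomial (Fin 4) K) :
    (toricAug K n v : Polynomial K) = toricMap K n (v 0) := rfl

theorem exact_toricAug (h : KomedaRelations n p q a b c) :
    Function.Exact (komedaMatrix₀ K p q a b c).mulVecLin (toricAug K n) := by
  have hrow : ∀ j, komedaMatrix₀ K p q a b c 0 j = komedaBinomial K p q a b c j := by
    intro j
    fin_cases j <;> rfl
  intro v
  rw [← Subtype.coe_inj, coe_toricAug, ZeroMemClass.coe_zero]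
  constructor
  · intro hv
    obtain ⟨w, hw⟩ := (Ideal.mem_span_range_iff_exists_fun).1
      (mem_komedaIdeal_of_toricMap_eq_zero h hv)
    refine ⟨w, ?_⟩
    funext k
    rw [Subsingleton.elim k 0, ← hw]
    simp [Matrix.mulVec, dotProduct, hrow, mul_comm]
  · rintro ⟨w, rfl⟩
    simp [Matrix.mulVec, dotProduct, hrow, toricMap_komedaBinomial h]

theorem exact_komedaMatrix₀ (h : KomedaRelations n p q a b c) :
    Function.Exact (komedaMatrix₁ K p q a b c).mulVecLin
      (komedaMatrix₀ K p q a b c).mulVecLin := by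
  have hcomp : ∀ w, (komedaMatrix₀ K p q a b c).mulVecLin
      ((komedaMatrix₁ K p q a b c).mulVecLin w) = 0 := fun w => by
    simp [Matrix.mulVec_mulVec, komedaMatrix₀_mul_komedaMatrix₁]
  refine fun v => ⟨fun hv => ?_, ?_⟩
  · exact mem_range_of_exact_mod_X (degR := komedaDeg₂ n p q a b c)
      (degS := komedaDeg₁ n p q a b c) (h.n_pos 0)
      (fun j k => by
        rw [mulVecLin_single]
        exact komedaMatrix₁_homogeneous h j k)
      hcomp (komedaMatrix₀_mod h.p_pos.ne' h.q_pos.ne') v hv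
  · rintro ⟨w, rfl⟩
    exact hcomp w

theorem exact_komedaMatrix₁ (h : KomedaRelations n p q a b c) :
    Function.Exact (komedaMatrix₂ K p q a b c).mulVecLin
      (komedaMatrix₁ K p q a b c).mulVecLin := by
  have hcomp : ∀ w, (komedaMatrix₁ K p q a b c).mulVecLin
      ((komedaMatrix₂ K p q a b c).mulVecLin w) = 0 := fun w => by
    simp [Matrix.mulVec_mulVec, komedaMatrix₁_mul_komedaMatrix₂]
  refine fun v => ⟨fun hv => ?_, ?_⟩
  · exact mem_range_of_exact_mod_X (degR := komedaDeg₃ n p q a b c)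
      (degS := komedaDeg₂ n p q a b c) (h.n_pos 0)
      (fun j k => by
        rw [mulVecLin_single]
        exact komedaMatrix₂_homogeneous h j k)
      hcomp (komedaMatrix₁_mod h.p_pos.ne' h.q_pos.ne') v hv
  · rintro ⟨w, rfl⟩
    exact hcomp w

theorem constantCoeff_komedaMatrix₀ (h : KomedaRelations n p q a b c) (j : Fin 5) (k : Fin 1) :
    constantCoeff (komedaMatrix₀ K p q a b c k j) = 0 := by
  fin_cases k
  fin_cases j <;> simp [komedaMatrix₀, h.p_pos.ne', h.q_pos.ne', h.c_pos.ne']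

theorem constantCoeff_komedaMatrix₁ (h : KomedaRelations n p q a b c) (j : Fin 6) (k : Fin 5) :
    constantCoeff (komedaMatrix₁ K p q a b c k j) = 0 := by
  fin_cases k <;> fin_cases j <;>
    simp [komedaMatrix₁, h.p_pos.ne', h.q_pos.ne', h.a_pos.ne', h.b_pos.ne', h.c_pos.ne']

theorem constantCoeff_komedaMatrix₂ (h : KomedaRelations n p q a b c) (j : Fin 2) (k : Fin 6) :
    constantCoeff (komedaMatrix₂ K p q a b c k j) = 0 := by
  fin_cases k <;> fin_cases j <;>
    simp [komedaMatrix₂, h.p_pos.ne', h.q_pos.ne', h.a_pos.ne', h.b_pos.ne', h.c_pos.ne']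

/-- The ranks of the free modules in the resolution. -/
def komedaRank : ℕ → ℕ
  | 0 => 1
  | 1 => 5
  | 2 => 6
  | 3 => 2
  | _ => 0

variable (n p q a b c) in
/-- The degrees of the basis elements in the resolution. -/
def komedaDeg : ∀ i, Fin (komedaRank i) → ℕ
  | 0 => fun _ => 0
  | 1 => komedaDeg₁ n p q a b c
  | 2 => komedaDeg₂ n p q a b c
  | 3 => komedaDeg₃ n p q a b c
  | _ + 4 => Fin.elim0

variable (K p q a b c) in
/-- The differentials of the resolution. -/
def komedaDifferential : ∀ i,
    (Fin (komedaRank (i + 1)) → MvPolynomial (Fin 4) K) →ₗ[MvPolynomial (Fin 4) K]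
      (Fin (komedaRank i) → MvPolynomial (Fin 4) K)
  | 0 => (komedaMatrix₀ K p q a b c).mulVecLin
  | 1 => (komedaMatrix₁ K p q a b c).mulVecLin
  | 2 => (komedaMatrix₂ K p q a b c).mulVecLin
  | _ + 3 => 0

variable (K) in
/-- The minimal graded free resolution of the semigroup ring. -/
def komedaResolution (h : KomedaRelations n p q a b c) : MinimalGradedResolution K n where
  rank := komedaRank
  deg := komedaDeg n p q a b c
  d := komedaDifferential K p q a b c
  aug := toricAug K n
  d_homogeneous
    | 0, j => fun k => by
      rw [show komedaDifferential K p q a b c 0 (Pi.single j 1) k = _ from mulVecLin_single _ j k]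
      exact komedaMatrix₀_homogeneous h j k
    | 1, j => fun k => by
      rw [show komedaDifferential K p q a b c 1 (Pi.single j 1) k = _ from mulVecLin_single _ j k]
      exact komedaMatrix₁_homogeneous h j k
    | 2, j => fun k => by
      rw [show komedaDifferential K p q a b c 2 (Pi.single j 1) k = _ from mulVecLin_single _ j k]
      exact komedaMatrix₂_homogeneous h j k
    | _ + 3, j => Fin.elim0 j
  aug_homogeneous j := by
    refine ⟨1, ?_⟩
    obtain rfl : j = (0 : Fin 1) := Subsingleton.elim (α := Fin 1) j 0
    exact map_one (toricMap K n)
  aug_surjective y := by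
    obtain ⟨x, hx⟩ := (toricMap K n).rangeRestrict_surjective y
    exact ⟨fun _ => x, hx⟩
  exact_zero := exact_toricAug h
  exact_succ
    | 0 => exact_komedaMatrix₀ h
    | 1 => exact_komedaMatrix₁ h
    | 2 => fun v => by
      refine ⟨fun hv => ⟨0, ?_⟩, ?_⟩
      · exact (komedaMatrix₂_injective h.p_pos.ne' v hv).symm
      · rintro ⟨w, rfl⟩
        exact map_zero _
    | _ + 3 => fun v => ⟨fun _ => ⟨0, funext fun k => Fin.elim0 k⟩, fun _ => rfl⟩
  minimal
    | 0, j, k => by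
      rw [show komedaDifferential K p q a b c 0 (Pi.single j 1) k = _ from mulVecLin_single _ j k]
      exact constantCoeff_komedaMatrix₀ h j k
    | 1, j, k => by
      rw [show komedaDifferential K p q a b c 1 (Pi.single j 1) k = _ from mulVecLin_single _ j k]
      exact constantCoeff_komedaMatrix₁ h j k
    | 2, j, k => by
      rw [show komedaDifferential K p q a b c 2 (Pi.single j 1) k = _ from mulVecLin_single _ j k]
      exact constantCoeff_komedaMatrix₂ h j k
    | _ + 3, j, _ => Fin.elim0 j

end Resolution

/-! ### The degrees of the resolution -/

section Degrees

variable {K : Type*} [Field K] {n : Fin 4 → ℕ} {p q a b c : ℕ}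

/-- Neither of `d`, `e` is the other one plus an element of the semigroup. -/
def IsIncomparable (n : Fin 4 → ℕ) (d e : ℕ) : Prop :=
  (∀ u : Fin 4 →₀ ℕ, d ≠ Finsupp.weight n u + e) ∧ ∀ u : Fin 4 →₀ ℕ, e ≠ Finsupp.weight n u + d

theorem ne_weight_add (h : KomedaRelations n p q a b c) {d e : ℕ} (m₀ m₁ m₂ m₃ k₀ k₁ k₂ k₃ : ℕ)
    (hm : IsIndispensableExponent p q a b c m₀ m₁ m₂ m₃)
    (hk : m₀ < k₀ ∨ m₁ < k₁ ∨ m₂ < k₂ ∨ m₃ < k₃)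
    (hd : d + (k₀ * n 0 + k₁ * n 1 + k₂ * n 2 + k₃ * n 3) =
      e + (m₀ * n 0 + m₁ * n 1 + m₂ * n 2 + m₃ * n 3)) (u : Fin 4 →₀ ℕ) :
    d ≠ Finsupp.weight n u + e := fun hu =>
  weight_ne_weight_add h m₀ m₁ m₂ m₃ k₀ k₁ k₂ k₃ hm hk u (by omega)

/-- The tool for the comparisons below: d - e is the difference of the degrees of two monomials,
each alone in its degree and neither dividing the other. If d - e were the degree of some X^u, then
X^u X^k would equal X^m. -/
theorem isIncomparable_of_exponents (h : KomedaRelations n p q a b c) {d e : ℕ}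
    (m₀ m₁ m₂ m₃ k₀ k₁ k₂ k₃ : ℕ)
    (hd : d + (k₀ * n 0 + k₁ * n 1 + k₂ * n 2 + k₃ * n 3) =
      e + (m₀ * n 0 + m₁ * n 1 + m₂ * n 2 + m₃ * n 3))
    (hm : IsIndispensableExponent p q a b c m₀ m₁ m₂ m₃ ∧
      IsIndispensableExponent p q a b c k₀ k₁ k₂ k₃ ∧
      (m₀ < k₀ ∨ m₁ < k₁ ∨ m₂ < k₂ ∨ m₃ < k₃) ∧ (k₀ < m₀ ∨ k₁ < m₁ ∨ k₂ < m₂ ∨ k₃ < m₃)) :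
    IsIncomparable n d e :=
  ⟨ne_weight_add h m₀ m₁ m₂ m₃ k₀ k₁ k₂ k₃ hm.1 hm.2.2.1 hd,
    ne_weight_add h k₀ k₁ k₂ k₃ m₀ m₁ m₂ m₃ hm.2.1 hm.2.2.2 hd.symm⟩

theorem IsIncomparable.symm {d e : ℕ} (h : IsIncomparable n d e) : IsIncomparable n e d :=
  ⟨h.2, h.1⟩

theorem IsIncomparable.congr {d e d' e' : ℕ} (h : IsIncomparable n d e) (hd : d' + e = e' + d) :
    IsIncomparable n d' e' :=
  ⟨fun u hu => h.1 u (by omega), fun u hu => h.2 u (by omega)⟩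

/-- The degrees are those of X 0 ^ p * X 3 and X 0 ^ q * X 1. Cancelling the smaller power of X 0,
which is positive, leaves monomials that are alone in their degrees. -/
theorem isIncomparable_deg_second_third (h : KomedaRelations n p q a b c) :
    IsIncomparable n ((a + 1) * n 1) ((b + 1) * n 2) := by
  have h₂ := h.rel₂
  have h₃ := h.rel₃
  have hp := h.p_pos
  have hq := h.q_pos
  have ha := h.a_pos
  have hb := h.b_pos
  have hc := h.c_pos
  rcases le_total p q with hpq | hpq
  · obtain ⟨r, rfl⟩ := Nat.exists_eq_add_of_le hpq
    exact isIncomparable_of_exponents h 0 0 0 1 r 1 0 0 (by linarith)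
      (by unfold IsIndispensableExponent; omega)
  · obtain ⟨r, rfl⟩ := Nat.exists_eq_add_of_le hpq
    exact isIncomparable_of_exponents h r 0 0 1 0 1 0 0 (by linarith)
      (by unfold IsIndispensableExponent; omega)

theorem isIncomparable_komedaDeg₁ (h : KomedaRelations n p q a b c) (hq2 : 2 ≤ q)
    (j k : Fin 5) (hjk : j < k) :
    IsIncomparable n (komedaDeg₁ n p q a b c j) (komedaDeg₁ n p q a b c k) := by
  have h₁ := h.rel₁
  have h₂ := h.rel₂
  have h₃ := h.rel₃
  have h₄ := h.rel₄
  have h₅ := h.rel₅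
  have hp := h.p_pos
  have hb := h.b_pos
  have hc := h.c_pos
  have h12 := isIncomparable_deg_second_third h
  obtain ⟨q, rfl⟩ := Nat.exists_eq_add_of_le' (show 1 ≤ q by omega)
  obtain ⟨a, rfl⟩ := Nat.exists_eq_add_of_le' (show 1 ≤ a from h.a_pos)
  fin_cases j <;> fin_cases k <;> first | exact absurd hjk (by decide) | skip
  all_goals
    simp only [komedaDeg₁, Fin.zero_eta, Fin.mk_one, Fin.reduceFinMk, Fin.isValue,
      Matrix.cons_val, Matrix.cons_val_zero, Matrix.cons_val_one]
  · exact isIncomparable_of_exponents h (q + 1 + 1) 0 0 0 0 0 0 1 (by linarith)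
      (by unfold IsIndispensableExponent; omega)
  · exact isIncomparable_of_exponents h (p + 1) 0 0 0 0 1 0 0 (by linarith)
      (by unfold IsIndispensableExponent; omega)
  · exact isIncomparable_of_exponents h 0 0 1 0 0 0 0 1 (by linarith)
      (by unfold IsIndispensableExponent; omega)
  · exact isIncomparable_of_exponents h 0 0 1 0 0 1 0 0 (by linarith)
      (by unfold IsIndispensableExponent; omega)
  · exact h12
  · exact isIncomparable_of_exponents h p 0 0 0 0 0 0 c (by linarith)
      (by unfold IsIndispensableExponent; omega)
  · exact isIncomparable_of_exponents h 0 (a + 1) 0 0 0 0 0 c (by linarith)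
      (by unfold IsIndispensableExponent; omega)
  -- Here q and a are one less than the original parameters: X 0 * X 1 has been cancelled from X 0 ^
  -- q * X 1 and X 0 * X 1 ^ a * X 2 ^ b. The bound `hq2` keeps the remaining power of X 0
  -- nontrivial.
  · exact isIncomparable_of_exponents h q 0 0 0 0 a b 0 (by linarith)
      (by unfold IsIndispensableExponent; omega)
  · exact isIncomparable_of_exponents h 0 0 1 0 (p + 1) 0 0 0 (by linarith)
      (by unfold IsIndispensableExponent; omega)
  · exact isIncomparable_of_exponents h 0 0 0 1 0 1 0 0 (by linarith)
      (by unfold IsIndispensableExponent; omega)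

theorem isIncomparable_komedaDeg₂ (h : KomedaRelations n p q a b c) (hc2 : 2 ≤ c)
    (j k : Fin 6) (hjk : j < k) :
    IsIncomparable n (komedaDeg₂ n p q a b c j) (komedaDeg₂ n p q a b c k) := by
  have h₁ := h.rel₁
  have h₂ := h.rel₂
  have h₃ := h.rel₃
  have h₄ := h.rel₄
  have h₅ := h.rel₅
  have hp := h.p_pos
  have hq := h.q_pos
  have ha := h.a_pos
  have hb := h.b_pos
  have h12 := isIncomparable_deg_second_third h
  obtain ⟨c, rfl⟩ := Nat.exists_eq_add_of_le' (show 1 ≤ c by omega)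
  fin_cases j <;> fin_cases k <;> first | exact absurd hjk (by decide) | skip
  all_goals
    simp only [komedaDeg₂, Fin.zero_eta, Fin.mk_one, Fin.reduceFinMk, Fin.isValue,
      Matrix.cons_val, Matrix.cons_val_zero, Matrix.cons_val_one]
  · exact isIncomparable_of_exponents h 1 0 0 0 0 0 0 1 (by linarith)
      (by unfold IsIndispensableExponent; omega)
  · exact isIncomparable_of_exponents h 0 1 0 0 0 0 b 0 (by linarith)
      (by unfold IsIndispensableExponent; omega)
  · exact isIncomparable_of_exponents h 0 0 1 0 0 0 0 1 (by linarith)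
      (by unfold IsIndispensableExponent; omega)
  · exact isIncomparable_of_exponents h 0 1 0 0 0 0 0 1 (by linarith)
      (by unfold IsIndispensableExponent; omega)
  · exact isIncomparable_of_exponents h 0 0 1 0 0 a 0 0 (by linarith)
      (by unfold IsIndispensableExponent; omega)
  -- Here c is one less than the original parameter, and `hc2` makes it positive; for value 0 the
  -- degrees would differ by p * n 0.
  · exact isIncomparable_of_exponents h p 0 0 0 0 0 0 c (by linarith)
      (by unfold IsIndispensableExponent; omega)
  · exact isIncomparable_of_exponents h 0 0 1 0 1 0 0 0 (by linarith)
      (by unfold IsIndispensableExponent; omega)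
  · exact isIncomparable_of_exponents h 0 1 0 0 1 0 0 0 (by linarith)
      (by unfold IsIndispensableExponent; omega)
  -- The two directions use different expressions of the same difference of degrees, by `rel₁` and
  -- `rel₃` together and by `rel₃` alone.
  · exact ⟨ne_weight_add h 0 1 1 0 (p + 1) 0 0 0 (by unfold IsIndispensableExponent; omega)
      (by omega) (by linarith), ne_weight_add h 0 0 0 (c + 1) q 1 0 0
        (by unfold IsIndispensableExponent; omega) (by omega) (by linarith)⟩
  · exact isIncomparable_of_exponents h q 0 0 0 0 0 0 1 (by linarith)
      (by unfold IsIndispensableExponent; omega)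
  · exact isIncomparable_of_exponents h 0 0 b 0 0 0 0 1 (by linarith)
      (by unfold IsIndispensableExponent; omega)
  · exact h12.symm.congr (by linarith)
  · exact isIncomparable_of_exponents h 0 1 0 0 0 0 1 0 (by linarith)
      (by unfold IsIndispensableExponent; omega)
  · exact isIncomparable_of_exponents h 0 1 0 0 p 0 0 0 (by linarith)
      (by unfold IsIndispensableExponent; omega)
  · exact isIncomparable_of_exponents h 0 0 1 0 p 0 0 0 (by linarith)
      (by unfold IsIndispensableExponent; omega)

theorem isIncomparable_komedaDeg₃ (h : KomedaRelations n p q a b c) (j k : Fin 2) (hjk : j < k) :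
    IsIncomparable n (komedaDeg₃ n p q a b c j) (komedaDeg₃ n p q a b c k) := by
  have h₁ := h.rel₁
  have h₂ := h.rel₂
  have h₃ := h.rel₃
  have h₄ := h.rel₄
  have h₅ := h.rel₅
  have hp := h.p_pos
  have hq := h.q_pos
  have ha := h.a_pos
  have hb := h.b_pos
  have hc := h.c_pos
  fin_cases j <;> fin_cases k <;> first | exact absurd hjk (by decide) | skip
  simp only [komedaDeg₃, Fin.zero_eta, Fin.mk_one, Fin.isValue, Matrix.cons_val_zero,
    Matrix.cons_val_one]
  exact isIncomparable_of_exponents h 1 0 0 0 0 0 0 c (by linarith)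
    (by unfold IsIndispensableExponent; omega)

theorem ne_weight_add_of_lt_isIncomparable {r : ℕ} {deg : Fin r → ℕ}
    (hdeg : ∀ j k, j < k → IsIncomparable n (deg j) (deg k)) (j k : Fin r) (hjk : j ≠ k)
    (u : Fin 4 →₀ ℕ) : deg j ≠ Finsupp.weight n u + deg k := by
  rcases lt_or_gt_of_ne hjk with hlt | hlt
  · exact (hdeg j k hlt).1 u
  · exact (hdeg k j hlt).2 u

theorem komedaResolution_stronglyIndispensable (h : KomedaRelations n p q a b c) (hq : 2 ≤ q)
    (hc : 2 ≤ c) : (komedaResolution K h).StronglyIndispensable := by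
  refine MinimalGradedResolution.stronglyIndispensable_of_deg h.n_pos _ fun i => ?_
  match i with
  | 0 => exact fun j k hjk => absurd (Subsingleton.elim (α := Fin 1) j k) hjk
  | 1 => exact ne_weight_add_of_lt_isIncomparable (isIncomparable_komedaDeg₁ h hq)
  | 2 => exact ne_weight_add_of_lt_isIncomparable (isIncomparable_komedaDeg₂ h hc)
  | 3 => exact ne_weight_add_of_lt_isIncomparable (isIncomparable_komedaDeg₃ h)
  | _ + 4 => exact fun j => Fin.elim0 j

theorem exponent_ne_zero {e₀ e₁ e₂ e₃ : ℕ} (h : 0 < e₀ ∨ 0 < e₁ ∨ 0 < e₂ ∨ 0 < e₃) :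
    exponent e₀ e₁ e₂ e₃ ≠ 0 := fun h0 => by
  have := (exponent_le_iff (u := 0)).1 h0.le
  simp only [Finsupp.coe_zero, Pi.zero_apply] at this
  omega

theorem not_stronglyIndispensable (h : KomedaRelations n p q a b c) (hqc : q = 1 ∨ c = 1)
    (F : MinimalGradedResolution K n) : ¬ F.StronglyIndispensable := by
  have : Subsingleton (Fin ((komedaResolution K h).rank 0)) :=
    inferInstanceAs (Subsingleton (Fin 1))
  have h₁ := h.rel₁
  have h₂ := h.rel₂
  have h₃ := h.rel₃
  have h₄ := h.rel₄
  have hb := h.b_pos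
  have hp := h.p_pos
  rcases hqc with rfl | rfl
  · obtain ⟨a, rfl⟩ := Nat.exists_eq_add_of_le' (show 1 ≤ a from h.a_pos)
    refine MinimalGradedResolution.not_stronglyIndispensable_of_deg (komedaResolution K h) 0
      (j := (3 : Fin 5)) (k := (2 : Fin 5)) (u := exponent 0 a b 0) (show (3 : Fin 5) ≠ 2 by decide)
      (exponent_ne_zero (by omega)) ?_ F
    rw [weight_exponent]
    change (c + 1) * n 3 = _ + (b + 1) * n 2
    linarith
  · refine MinimalGradedResolution.not_stronglyIndispensable_of_deg (komedaResolution K h) 1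
      (j := (1 : Fin 6)) (k := (2 : Fin 6)) (u := exponent p 0 0 0) (show (1 : Fin 6) ≠ 2 by decide)
      (exponent_ne_zero (by omega)) ?_ F
    rw [weight_exponent]
    change (a + 1) * n 1 + (b + 1) * n 2 = _ + ((p + q + 1) * n 0 + b * n 2)
    linarith

end Degrees

end

/-! ### Passage to natural parameters and conclusion -/

theorem theorem2p6 {K : Type*} [Field K] (n : Fin 4 → ℕ) (hn : IsMinimalGenerators n)
    (hS : IsPseudoSymmetric (numSemigroup n))
    (α₁ α₂ α₃ α₄ α₂₁ : ℤ)
    (hα₁ : 1 < α₁) (hα₂ : 1 < α₂) (hα₃ : 1 < α₃) (hα₄ : 1 < α₄)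
    (hα₂₁ : 0 < α₂₁) (hα₂₁' : α₂₁ < α₁)
    (h₁ : (n 0 : ℤ) = α₂ * α₃ * (α₄ - 1) + 1)
    (h₂ : (n 1 : ℤ) = α₂₁ * α₃ * α₄ + (α₁ - α₂₁ - 1) * (α₃ - 1) + α₃)
    (h₃ : (n 2 : ℤ) = α₁ * α₄ + (α₁ - α₂₁ - 1) * (α₂ - 1) * (α₄ - 1) - α₄ + 1)
    (h₄ : (n 3 : ℤ) = α₁ * α₂ * (α₃ - 1) + α₂₁ * (α₂ - 1) + α₂) :
    (∃ F : MinimalGradedResolution K n, F.StronglyIndispensable) ↔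
      α₄ > 2 ∧ α₁ - α₂₁ > 2 := by
  obtain ⟨p, hp⟩ := Int.eq_ofNat_of_zero_le hα₂₁.le
  obtain ⟨q, hq⟩ := Int.eq_ofNat_of_zero_le (show 0 ≤ α₁ - α₂₁ - 1 by omega)
  obtain ⟨a, ha⟩ := Int.eq_ofNat_of_zero_le (show 0 ≤ α₂ - 1 by omega)
  obtain ⟨b, hb⟩ := Int.eq_ofNat_of_zero_le (show 0 ≤ α₃ - 1 by omega)
  obtain ⟨c, hc⟩ := Int.eq_ofNat_of_zero_le (show 0 ≤ α₄ - 1 by omega)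
  obtain rfl : α₁ = p + q + 1 := by omega
  obtain rfl : α₂ = a + 1 := by omega
  obtain rfl : α₃ = b + 1 := by omega
  obtain rfl : α₄ = c + 1 := by omega
  subst hp
  -- The hypotheses allow α₂₁ = α₁ - 1, but then n 1 is a multiple of n 2 and the generators are not
  -- minimal.
  have hq0 : q ≠ 0 := by
    rintro rfl
    have h12 : n 1 = (b + 1) * n 2 := by
      zify
      rw [h₂, h₃]
      push_cast
      ring
    refine hn.minimal 1 ?_
    rw [h12, ← smul_eq_mul]
    exact AddSubmonoid.nsmul_mem _ (AddSubmonoid.subset_closure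
      (Set.mem_image_of_mem n (show (2 : Fin 4) ≠ 1 by decide))) _
  have h : KomedaRelations n p q a b c :=
    { n_pos := hn.pos
      gcd_eq_one := hn.gcd_eq_one
      p_pos := by omega
      q_pos := by omega
      a_pos := by omega
      b_pos := by omega
      c_pos := by omega
      n_zero := by zify; rw [h₁]; ring
      rel₁ := by zify; rw [h₁, h₃, h₄]; ring
      rel₂ := by zify; rw [h₁, h₂, h₄]; ring
      rel₃ := by zify; rw [h₁, h₂, h₃]; ring
      rel₄ := by zify; rw [h₁, h₂, h₃, h₄]; ring
      rel₅ := by zify; rw [h₁, h₂, h₃, h₄]; ring }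
  constructor
  · rintro ⟨F, hF⟩
    by_contra hne
    exact not_stronglyIndispensable h (by omega) F hF
  · rintro ⟨hc, hq⟩
    exact ⟨komedaResolution K h, komedaResolution_stronglyIndispensable h (by omega) (by omega)⟩
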